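/- Fix a universal prefix-free oracle Turing machine $U$ and let $K^A(\sigma\mid\tau)$ be the least length of a program $\pi\in\{0,1\}^*$ with $U^A(\pi,\tau)=\sigma$, with $K^A(\sigma)=K^A(\sigma\mid\lambda)$ for the empty string $\lambda$; rational vectors are treated as finite objects by a standard encoding. For $x\in\mathbb R^m$, $y\in\mathbb R^n$ and integers $r,s$ put $$K^A_r(x)=\min\{K^A(p): p\in B_{2^{-r}}(x)\cap\mathbb Q^m\},\qquad K^A_{r,s}(x\mid y)=\max_{q\in B_{2^{-s}}(y)\cap\mathbb Q^n}\ \min_{p\in B_{2^{-r}}(x)\cap\mathbb Q^m}K^A(p\mid q),$$ where $B_\rho(x)$ is the open Euclidean ball; real precisions are rounded up to the next integer, and no superscript means $A=\emptyset$. For $e\in\mathbb R^n$ and $i,j\in\{1,\dots,n\}$ let $K^{e-\{e_i,e_j\}}$ denote complexity relative to an oracle set that encodes the binary expansions of the coordinates $e_k$, $k\ne i,j$. Let $z\in\mathbb R^n$ and $e\in S^{n-1}$. There is a constant $C$, depending only on $U$, $n$, $z$ and $e$, such that for every integer $r\ge 2$ and every $w\in\mathbb R^n$ with $w\ne z$,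 $e\cdot z=e\cdot w$ and $t:=-\log_2\|z-w\|\le r$, there are distinct indices $i,j\in\{1,\dots,n\}$ with $$K_r(w)\ \ge\ K_t(z)+K^{e-\{e_i,e_j\}}_{r-t,\,r}(e\mid z)-C\log_2 r.$$ -/

import Mathlib

noncomputable section

/-! ### Oracle machines -/

/-- Programs of oracle machines: the usual codes for partial recursive functions on `ℕ`, with one
further instruction `oracle` that queries the oracle set. -/
inductive OracleCode : Type
  | zero : OracleCode
  | succ : OracleCode
  | left : OracleCode
  | right : OracleCode
  | oracle : OracleCode
  | pair : OracleCode → OracleCode → OracleCode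
  | comp : OracleCode → OracleCode → OracleCode
  | prec : OracleCode → OracleCode → OracleCode
  | rfind' : OracleCode → OracleCode

namespace OracleCode

open Classical in
/-- The partial function computed by an oracle machine with oracle set `A`. The clauses other than
`oracle` are those of `Nat.Partrec.Code.eval`; a query `n` is answered by `1` if `n ∈ A` and
by `0` otherwise. -/
def eval (A : Set ℕ) : OracleCode → ℕ →. ℕ
  | zero => fun _ => Part.some 0
  | succ => fun n => Part.some (n + 1)
  | left => fun n => Part.some n.unpair.1
  | right => fun n => Part.some n.unpair.2
  | oracle => fun n => Part.some (if n ∈ A then 1 else 0)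
  | pair cf cg => fun n => Nat.pair <$> eval A cf n <*> eval A cg n
  | comp cf cg => fun n => eval A cg n >>= eval A cf
  | prec cf cg =>
    Nat.unpaired fun a n =>
      n.rec (eval A cf a) fun y IH => do
        let i ← IH
        eval A cg (Nat.pair a (Nat.pair y i))
  | rfind' cf =>
    Nat.unpaired fun a m =>
      (Nat.rfind fun n => (fun m => m = 0) <$> eval A cf (Nat.pair a (n + m))).map (· + m)

/-- `M.run A π y`: the result of the machine `M` with oracle `A` on the program `π ∈ {0,1}*` and the
conditional information `y`. Conditional information and results are finite objects, given by
their code numbers. -/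
def run (M : OracleCode) (A : Set ℕ) (π : List Bool) (y : ℕ) : Part ℕ :=
  M.eval A (Encodable.encode (π, y))

/-- `M` is a prefix-free oracle machine: for every oracle and every conditional information, no
halting program is a proper prefix of another one. -/
def IsPrefixFree (M : OracleCode) : Prop :=
  ∀ (A : Set ℕ) (y : ℕ) (π ρ : List Bool),
    (M.run A π y).Dom → (M.run A ρ y).Dom → π <+: ρ → π = ρ

/-- `U` is a universal (additively optimal) prefix-free oracle machine: it is prefix-free, and it
simulates every prefix-free oracle machine `M`, with programs that are longer by at most a constant
that depends only on `M`. -/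
def IsUniversalPrefixFree (U : OracleCode) : Prop :=
  U.IsPrefixFree ∧
    ∀ M : OracleCode, M.IsPrefixFree → ∃ c : ℕ, ∀ (A : Set ℕ) (π : List Bool) (y x : ℕ),
      x ∈ M.run A π y → ∃ ρ : List Bool, x ∈ U.run A ρ y ∧ ρ.length ≤ π.length + c

end OracleCode

/-! ### Kolmogorov complexity of finite objects -/

/-- `K^A(σ ∣ τ)`, the conditional Kolmogorov complexity of `σ` given `τ` with respect to the
machine `U` and the oracle `A`: the least length of a program that yields `σ` from `τ`
(`⊤` if there were none). -/
def condComplexity {α β : Type*} [Encodable α] [Encodable β]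
    (U : OracleCode) (A : Set ℕ) (σ : α) (τ : β) : ℕ∞ :=
  ⨅ (π : List Bool) (_ : Encodable.encode σ ∈ U.run A π (Encodable.encode τ)), (π.length : ℕ∞)

/-- `K^A(σ) = K^A(σ ∣ λ)` with the empty string `λ`. -/
def complexity {α : Type*} [Encodable α] (U : OracleCode) (A : Set ℕ) (σ : α) : ℕ∞ :=
  condComplexity U A σ ([] : List Bool)

/-- A rational vector as a finite object: the list of its numerators and denominators. -/
def ratVecData {n : ℕ} (p : Fin n → ℚ) : List (ℤ × ℕ) :=
  List.ofFn fun k => ((p k).num, (p k).den)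

/-! ### Kolmogorov complexity of points of Euclidean space -/

/-- The rational points of the open ball `B_{2^{-r}}(x)`. The precision `r` may be any integer. -/
def ratBall {n : ℕ} (r : ℤ) (x : EuclideanSpace ℝ (Fin n)) : Set (Fin n → ℚ) :=
  {p | WithLp.toLp 2 (fun k => (p k : ℝ)) ∈ Metric.ball x ((2 : ℝ) ^ (-r))}

/-- `K^A_r(x)`, the Kolmogorov complexity of the point `x` at precision `r`. -/
def pointComplexity (U : OracleCode) (A : Set ℕ) {n : ℕ} (r : ℤ)
    (x : EuclideanSpace ℝ (Fin n)) : ℕ∞ :=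
  ⨅ p ∈ ratBall r x, complexity U A (ratVecData p)

/-- `K^A_{r,s}(x ∣ y)`, the conditional Kolmogorov complexity of `x` at precision `r` given `y` at
precision `s`: the maximum over the precision-`s` estimates `q` of `y` of the least `K^A(p ∣ q)`
for a precision-`r` estimate `p` of `x`. -/
def pointCondComplexity (U : OracleCode) (A : Set ℕ) {m n : ℕ} (r s : ℤ)
    (x : EuclideanSpace ℝ (Fin m)) (y : EuclideanSpace ℝ (Fin n)) : ℕ∞ :=
  ⨆ q ∈ ratBall s y, ⨅ p ∈ ratBall r x, condComplexity U A (ratVecData p) (ratVecData q)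

/-! ### Real numbers as oracles -/

/-- The oracle set that encodes the binary expansions of a family of real numbers `y k`: for each
`k` it holds the integer part `⌊y k⌋`, and the positions `m ≥ 1` of the digits `1` in the binary
expansion of the fractional part of `y k`. -/
def realOracle {ι : Type*} [Encodable ι] (y : ι → ℝ) : Set ℕ :=
  {a | ∃ k : ι, a = Nat.pair (Encodable.encode k) (Nat.pair 0 (Encodable.encode ⌊y k⌋))} ∪
  {a | ∃ (k : ι) (m : ℕ), 1 ≤ m ∧ ⌊(2 : ℝ) ^ m * y k⌋ % 2 = 1 ∧
    a = Nat.pair (Encodable.encode k) (Nat.pair m 0)}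

/-- The tuple `e - {e_i, e_j}` of the coordinates of `e` other than the `i`-th and the `j`-th. -/
def removeTwo {n : ℕ} (e : EuclideanSpace ℝ (Fin n)) (i j : Fin n) :
    {k : Fin n // k ≠ i ∧ k ≠ j} → ℝ :=
  fun k => e k

end

/-! Let `w'` be a rational estimate of `w` whose program has length `ℓ = K_r(w)`, let `D = ‖z - w‖ =
2 ^ (-t)` and, for `t > 0`, let `d = ⌈t⌉`. The information in `w'` is split at the scale `2 ^ (-d)`,
at which `w` and `z` differ by a bounded number of grid cells only.

Counting (`exists_two_part_description`): among the at most `2 ^ ℓ` outputs of programs of length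
`ℓ`, about `2 ^ k` share with `w'` its truncation to `d` bits. Given the truncation, `w'` costs `k +
1` bits; the truncation itself is one of at most `2 ^ (ℓ - k)` truncations that are so frequent. Up
to a bounded correction it also describes `z` at precision `d`, so `K_t(z) ≤ ℓ - k + O(log r)`.
Conversely, every precision-`r` estimate `q` of `z` yields the truncation up to a bounded
correction, and then `k + 1` further bits yield `w'`.

Geometry: `w'` and `q` determine `v = w - z`, a vector of length `D` orthogonal to `e`, up to an
error of order `2 ^ (-r)`. With the other coordinates of `e` read from the oracle, orthogonality and
`‖e‖ = 1` are two equations for `e i` and `e j`, governed by the determinant `e i * v j - e j * v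
i`. Lagrange's identity (`exists_pair_le_abs_det`) provides a pair for which it is at least `D / n`,
and then the solution is stable with error of order `2 ^ (-r) / D = 2 ^ (-(r - t))`
(`sum_abs_le_of_near_solution`). A machine finds it by exhaustive search (`exists_search_code`); a
fixed rough approximation of `e`, built into the machine, singles out the right root of the
quadratic equation. So the direction costs `k + O(log r)` bits given `q`, and adding the two bounds
gives the theorem.

For `t ≤ 0` the term `K_t(z)` is bounded, and the whole program of `w'` can be spent on the
direction. -/

open Encodable

/-! ### Primitive recursive integer arithmetic -/

namespace Primrec

variable {α : Type*} [Primcodable α]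

theorem int_natCast : Primrec (fun k : ℕ => (k : ℤ)) := by
  refine Primrec.encode_iff.1 (Primrec.nat_double.of_eq fun k => ?_)
  rfl

/-- The code of an integer carries the sign in its parity, so `Int.toNat` and negation are
arithmetic on codes; the other operations are assembled from positive and negative parts. -/
theorem int_encode_cases (x : ℤ) :
    (∃ k : ℕ, x = k ∧ Encodable.encode x = 2 * k) ∨
      ∃ k : ℕ, x = -((k : ℤ) + 1) ∧ Encodable.encode x = 2 * k + 1 := by
  cases x with
  | ofNat k => exact Or.inl ⟨k, rfl, rfl⟩
  | negSucc k => exact Or.inr ⟨k, by rw [Int.negSucc_eq], rfl⟩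

theorem int_toNat : Primrec Int.toNat := by
  have h : Primrec fun x : ℤ =>
      if Encodable.encode x % 2 = 0 then Encodable.encode x / 2 else 0 :=
    Primrec.ite (Primrec.eq.comp (nat_mod.comp Primrec.encode (const 2)) (const 0))
      (nat_div.comp Primrec.encode (const 2)) (const 0)
  refine h.of_eq fun x => ?_
  rcases int_encode_cases x with ⟨k, hx, he⟩ | ⟨k, hx, he⟩
  · rw [he, hx]; simp
  · rw [he, if_neg (by omega)]; omega

theorem int_neg : Primrec (fun x : ℤ => -x) := by
  have h : Primrec fun x : ℤ =>
      if Encodable.encode x % 2 = 0 then Encodable.encode x - 1 else Encodable.encode x + 1 :=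
    Primrec.ite (Primrec.eq.comp (nat_mod.comp Primrec.encode (const 2)) (const 0))
      (nat_sub.comp Primrec.encode (const 1)) (nat_add.comp Primrec.encode (const 1))
  refine Primrec.encode_iff.1 (h.of_eq fun x => ?_)
  rcases int_encode_cases x with ⟨k, hx, he⟩ | ⟨k, hx, he⟩ <;>
    rcases int_encode_cases (-x) with ⟨k', hx', he'⟩ | ⟨k', hx', he'⟩ <;>
    rw [he, he'] <;> split_ifs <;> omega

theorem int_natSub : Primrec₂ (fun a b : ℕ => (a : ℤ) - b) := by
  have h : Primrec fun p : ℕ × ℕ =>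
      if p.2 ≤ p.1 then ((p.1 - p.2 : ℕ) : ℤ) else -((p.2 - p.1 : ℕ) : ℤ) :=
    Primrec.ite (nat_le.comp snd fst) (int_natCast.comp (nat_sub.comp fst snd))
      (int_neg.comp (int_natCast.comp (nat_sub.comp snd fst)))
  exact h.of_eq fun p => by dsimp only; split_ifs <;> omega

theorem int_posPart_sub (x : ℤ) : (x.toNat : ℤ) - ((-x).toNat : ℤ) = x := by omega

theorem int_add : Primrec₂ (fun x y : ℤ => x + y) := by
  have h : Primrec fun p : ℤ × ℤ =>
      ((p.1.toNat + p.2.toNat : ℕ) : ℤ) - (((-p.1).toNat + (-p.2).toNat : ℕ) : ℤ) :=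
    int_natSub.comp (nat_add.comp (int_toNat.comp fst) (int_toNat.comp snd))
      (nat_add.comp (int_toNat.comp (int_neg.comp fst)) (int_toNat.comp (int_neg.comp snd)))
  exact h.of_eq fun p => by dsimp only; omega

theorem int_sub : Primrec₂ (fun x y : ℤ => x - y) :=
  (int_add.comp fst (int_neg.comp snd)).of_eq fun _ => by ring

theorem int_mul : Primrec₂ (fun x y : ℤ => x * y) := by
  have hn := int_toNat.comp int_neg
  have h : Primrec fun p : ℤ × ℤ =>
      ((p.1.toNat * p.2.toNat + (-p.1).toNat * (-p.2).toNat : ℕ) : ℤ) -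
        ((p.1.toNat * (-p.2).toNat + (-p.1).toNat * p.2.toNat : ℕ) : ℤ) :=
    int_natSub.comp
      (nat_add.comp (nat_mul.comp (int_toNat.comp fst) (int_toNat.comp snd))
        (nat_mul.comp (hn.comp fst) (hn.comp snd)))
      (nat_add.comp (nat_mul.comp (int_toNat.comp fst) (hn.comp snd))
        (nat_mul.comp (hn.comp fst) (int_toNat.comp snd)))
  refine h.of_eq fun p => ?_
  nth_rw 5 [← int_posPart_sub p.1, ← int_posPart_sub p.2]
  push_cast
  ring

theorem int_le : PrimrecRel (fun x y : ℤ => x ≤ y) :=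
  PrimrecRel.of_eq
    (PrimrecPred.primrecRel (Primrec.eq.comp (int_toNat.comp int_sub) (const 0))
      : PrimrecRel fun x y : ℤ => (x - y).toNat = 0) fun x y => by dsimp only; omega

theorem int_natAbs : Primrec Int.natAbs :=
  (nat_add.comp int_toNat (int_toNat.comp int_neg)).of_eq fun x => by omega

theorem int_abs : Primrec (fun x : ℤ => |x|) :=
  (int_natCast.comp int_natAbs).of_eq fun x => by simp

/-- For negative `x` the quotient is minus the ceiling of `|x| / d`, and that ceiling is `(|x| + (d
- 1)) / d`. For `d = 0` both sides are `0`. -/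
theorem int_ediv_nat : Primrec₂ (fun (x : ℤ) (d : ℕ) => x / (d : ℤ)) := by
  have h : Primrec fun p : ℤ × ℕ =>
      if 0 ≤ p.1 then ((p.1.toNat / p.2 : ℕ) : ℤ)
      else -((((-p.1).toNat + (p.2 - 1)) / p.2 : ℕ) : ℤ) :=
    Primrec.ite (int_le.comp (const 0) fst)
      (int_natCast.comp (nat_div.comp (int_toNat.comp fst) snd))
      (int_neg.comp (int_natCast.comp (nat_div.comp
        (nat_add.comp (int_toNat.comp (int_neg.comp fst)) (nat_sub.comp snd (const 1))) snd)))
  refine h.of_eq fun ⟨x, d⟩ => ?_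
  simp only
  rcases Nat.eq_zero_or_pos d with rfl | hd
  · simp
  split_ifs with hx
  · push_cast
    rw [Int.toNat_of_nonneg hx]
  · obtain ⟨k, rfl⟩ : ∃ k : ℕ, x = -((k : ℤ) + 1) := ⟨(-x - 1).toNat, by omega⟩
    have h1 : (-(-((k : ℤ) + 1))).toNat + (d - 1) = k + d := by omega
    rw [h1, Nat.add_div_right _ hd]
    symm
    have hd' : (0 : ℤ) < d := by exact_mod_cast hd
    rw [Int.ediv_eq_iff_of_pos hd']
    have h2 := Nat.div_add_mod k d
    have h3 := Nat.mod_lt k hd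
    zify at h2 h3
    have h4 : (0 : ℤ) ≤ (k : ℤ) % d := Int.emod_nonneg _ hd'.ne'
    push_cast
    constructor <;> nlinarith

theorem two_pow : Primrec (fun k : ℕ => 2 ^ k) :=
  (Primrec₂.unpaired'.1 Nat.Primrec.pow).comp (const 2) Primrec.id

theorem int_two_pow : Primrec (fun k : ℕ => (2 : ℤ) ^ k) :=
  (int_natCast.comp two_pow).of_eq fun k => by push_cast; rfl

theorem int_sum {ι : Type*} (s : Finset ι) {f : ι → α → ℤ} (hf : ∀ i, Primrec (f i)) :
    Primrec fun a => ∑ i ∈ s, f i a := by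
  classical
  induction s using Finset.induction_on with
  | empty => exact (const 0).of_eq fun a => by simp
  | insert i s hi ih =>
    exact (int_add.comp (hf i) ih).of_eq fun a => by rw [Finset.sum_insert hi]

theorem forall_finset {ι : Type*} (s : Finset ι) {p : ι → α → Prop}
    (hp : ∀ i, PrimrecPred (p i)) : PrimrecPred fun a => ∀ i ∈ s, p i a := by
  classical
  induction s using Finset.induction_on with
  | empty => exact (Primrec.eq.comp (const 0) (const 0)).of_eq fun a => by simp
  | insert i s hi ih =>
    exact ((hp i).and ih).of_eq fun a => by simp

theorem fin_pi {σ : Type*} [Primcodable σ] {n : ℕ} {f : Fin n → α → σ}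
    (hf : ∀ i, Primrec (f i)) : Primrec fun a i => f i a :=
  fin_curry.2 (Primrec₂.swap (fin_curry₁.2 hf))

theorem fin_apply {σ : Type*} [Primcodable σ] {n : ℕ} {f : α → Fin n → σ}
    (hf : Primrec f) (i : Fin n) : Primrec fun a => f a i :=
  fin_app.comp hf (const i)

end Primrec

/-! ### Building oracle machines -/

namespace OracleCode

/-- An oracle-free code as an oracle machine that makes no queries. -/
def ofCode : Nat.Partrec.Code → OracleCode
  | .zero => zero
  | .succ => succ
  | .left => left
  | .right => right
  | .pair cf cg => pair (ofCode cf) (ofCode cg)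
  | .comp cf cg => comp (ofCode cf) (ofCode cg)
  | .prec cf cg => prec (ofCode cf) (ofCode cg)
  | .rfind' cf => rfind' (ofCode cf)

theorem eval_ofCode (A : Set ℕ) (c : Nat.Partrec.Code) : (ofCode c).eval A = c.eval := by
  induction c with
  | zero | succ | left | right => rfl
  | pair cf cg hf hg => simp only [ofCode, eval, Nat.Partrec.Code.eval, hf, hg]; rfl
  | comp cf cg hf hg => simp only [ofCode, eval, Nat.Partrec.Code.eval, hf, hg]; rfl
  | prec cf cg hf hg => simp only [ofCode, eval, Nat.Partrec.Code.eval, hf, hg]; rfl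
  | rfind' cf hf => simp only [ofCode, eval, Nat.Partrec.Code.eval, hf]; rfl

/-- With the empty oracle every query is answered by `0`. Hence the outputs of unrelativised
programs can be enumerated, on which the counting argument rests. -/
theorem partrec_eval_empty (c : OracleCode) : Nat.Partrec (c.eval ∅) := by
  induction c with
  | zero => exact Nat.Partrec.zero
  | succ => exact Nat.Partrec.succ
  | left => exact Nat.Partrec.left
  | right => exact Nat.Partrec.right
  | oracle =>
    exact Nat.Partrec.zero.of_eq fun k => by simp [eval]; rfl
  | pair cf cg hf hg => exact hf.pair hg
  | comp cf cg hf hg => exact hf.comp hg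
  | prec cf cg hf hg => exact hf.prec hg
  | rfind' cf hf => exact hf.rfind'

theorem exists_eval_eq_of_partrec {α σ : Type*} [Primcodable α] [Primcodable σ] {f : α →. σ}
    (hf : Partrec f) :
    ∃ c : OracleCode, ∀ (A : Set ℕ) (a : α), c.eval A (encode a) = (f a).map encode := by
  obtain ⟨c, hc⟩ := Nat.Partrec.Code.exists_code.1 hf
  refine ⟨ofCode c, fun A a => ?_⟩
  rw [eval_ofCode, hc]
  simp

theorem eval_comp_apply (A : Set ℕ) (cf cg : OracleCode) (a : ℕ) :
    (cf.comp cg).eval A a = (cg.eval A a).bind fun x => cf.eval A x :=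
  rfl

theorem eval_comp_of_eq {A : Set ℕ} {cf cg : OracleCode} {a x : ℕ}
    (hg : cg.eval A a = Part.some x) : (cf.comp cg).eval A a = cf.eval A x := by
  rw [eval_comp_apply, hg, Part.bind_some]

theorem eval_pair_of_eq {A : Set ℕ} {cf cg : OracleCode} {a x y : ℕ}
    (hf : cf.eval A a = Part.some x) (hg : cg.eval A a = Part.some y) :
    (cf.pair cg).eval A a = Part.some (Nat.pair x y) := by
  change (Nat.pair <$> cf.eval A a <*> cg.eval A a) = _
  rw [hf, hg]
  simp [Seq.seq]

/-- Total functions of an oracle and a number that are computed by one oracle machine. -/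
def OracleComputable (f : Set ℕ → ℕ → ℕ) : Prop :=
  ∃ c : OracleCode, ∀ (A : Set ℕ) (a : ℕ), c.eval A a = Part.some (f A a)

theorem OracleComputable.of_primrec {f : ℕ → ℕ} (hf : Primrec f) :
    OracleComputable fun _ => f := by
  obtain ⟨c, hc⟩ := exists_eval_eq_of_partrec hf.to_comp.partrec
  exact ⟨c, fun A a => by simpa using hc A a⟩

theorem OracleComputable.comp {f g : Set ℕ → ℕ → ℕ} (hf : OracleComputable f)
    (hg : OracleComputable g) : OracleComputable fun A a => f A (g A a) := by
  obtain ⟨cf, hf⟩ := hf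
  obtain ⟨cg, hg⟩ := hg
  exact ⟨cf.comp cg, fun A a => (eval_comp_of_eq (hg A a)).trans (hf A _)⟩

theorem OracleComputable.pair {f g : Set ℕ → ℕ → ℕ} (hf : OracleComputable f)
    (hg : OracleComputable g) : OracleComputable fun A a => Nat.pair (f A a) (g A a) := by
  obtain ⟨cf, hf⟩ := hf
  obtain ⟨cg, hg⟩ := hg
  exact ⟨cf.pair cg, fun A a => eval_pair_of_eq (hf A a) (hg A a)⟩

theorem OracleComputable.rec {f : Set ℕ → ℕ → ℕ} {g : Set ℕ → ℕ → ℕ}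
    (hf : OracleComputable f) (hg : OracleComputable g) :
    OracleComputable fun A => Nat.unpaired fun a k =>
      k.rec (f A a) fun y IH => g A (Nat.pair a (Nat.pair y IH)) := by
  obtain ⟨cf, hf⟩ := hf
  obtain ⟨cg, hg⟩ := hg
  refine ⟨cf.prec cg, fun A a => ?_⟩
  simp only [eval, Nat.unpaired]
  induction a.unpair.2 with
  | zero => simp [hf]
  | succ k ih =>
    change Part.bind (Nat.rec _ _ k) _ = _
    rw [ih, Part.bind_some, hg]

/-- The answer of the oracle `A` to the query `a`. -/
noncomputable def answer (A : Set ℕ) (a : ℕ) : ℕ :=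
  open Classical in if a ∈ A then 1 else 0

theorem oracleComputable_answer : OracleComputable answer :=
  ⟨oracle, fun _ _ => rfl⟩

/-- The number with integer part `v` and binary digits read from the block `k` of the oracle,
scaled by `2 ^ m` and truncated. -/
noncomputable def digitValue (A : Set ℕ) (k v : ℕ) : ℕ → ℕ
  | 0 => v
  | m + 1 => 2 * digitValue A k v m + answer A (Nat.pair k (Nat.pair (m + 1) 0))

theorem oracleComputable_digitValue (k v : ℕ) :
    OracleComputable fun A => digitValue A k v := by
  have hy : Primrec fun a : ℕ => a.unpair.2.unpair.1 :=
    Primrec.fst.comp (Primrec.unpair.comp (Primrec.snd.comp Primrec.unpair))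
  have hI : Primrec fun a : ℕ => a.unpair.2.unpair.2 :=
    Primrec.snd.comp (Primrec.unpair.comp (Primrec.snd.comp Primrec.unpair))
  have hq : Primrec fun a : ℕ => Nat.pair k (Nat.pair (a.unpair.2.unpair.1 + 1) 0) :=
    Primrec₂.natPair.comp (Primrec.const k)
      (Primrec₂.natPair.comp (Primrec.succ.comp hy) (Primrec.const 0))
  have hadd : Primrec fun a : ℕ => 2 * a.unpair.1 + a.unpair.2 :=
    Primrec.nat_add.comp (Primrec.nat_double.comp (Primrec.fst.comp Primrec.unpair))
      (Primrec.snd.comp Primrec.unpair)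
  have hstep := (OracleComputable.of_primrec hadd).comp
    ((OracleComputable.of_primrec hI).pair
      (oracleComputable_answer.comp (OracleComputable.of_primrec hq)))
  have hrec := OracleComputable.rec (OracleComputable.of_primrec (Primrec.const v)) hstep
  have h := hrec.comp (OracleComputable.of_primrec
    (Primrec₂.natPair.comp (Primrec.const 0) Primrec.id))
  obtain ⟨c, hc⟩ := h
  refine ⟨c, fun A m => (hc A m).trans ?_⟩
  simp only [Nat.unpaired, Nat.unpair_pair, id]
  congr 1
  induction m with
  | zero => rfl
  | succ m ih => simp only [ih, digitValue]

theorem oracleComputable_digitValues (ks : List (ℕ × ℕ)) :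
    OracleComputable fun A m => encode (ks.map fun p => digitValue A p.1 p.2 m) := by
  induction ks with
  | nil => exact OracleComputable.of_primrec (Primrec.const 0)
  | cons p ks ih =>
    have h := (OracleComputable.of_primrec Primrec.succ).comp
      ((oracleComputable_digitValue p.1 p.2).pair ih)
    obtain ⟨c, hc⟩ := h
    exact ⟨c, fun A m => (hc A m).trans (by simp)⟩

/-- A partial recursive function that may use truncations, at a computable precision, of the
numbers stored in the oracle. -/
theorem exists_eval_eq_digitValues {α σ : Type*} [Primcodable α] [Primcodable σ]
    (ks : List (ℕ × ℕ)) {m : α → ℕ} (hm : Primrec m) {G : α × List ℕ →. σ} (hG : Partrec G) :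
    ∃ B : OracleCode, ∀ (A : Set ℕ) (a : α), B.eval A (encode a) =
      (G (a, ks.map fun p => digitValue A p.1 p.2 (m a))).map encode := by
  obtain ⟨cG, hcG⟩ := exists_eval_eq_of_partrec hG
  obtain ⟨cm, hcm⟩ := exists_eval_eq_of_partrec hm.to_comp.partrec
  obtain ⟨cd, hcd⟩ := oracleComputable_digitValues ks
  obtain ⟨ci, hci⟩ := exists_eval_eq_of_partrec (Primrec.id (α := ℕ)).to_comp.partrec
  refine ⟨cG.comp (ci.pair (cd.comp cm)), fun A a => ?_⟩
  rw [← hcG A]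
  have hci' : ci.eval A (encode a) = Part.some (encode a) := by simpa using hci A (encode a)
  have hcm' : cm.eval A (encode a) = Part.some (m a) := by simpa using hcm A a
  have hd : (cd.comp cm).eval A (encode a) =
      Part.some (encode (ks.map fun p => digitValue A p.1 p.2 (m a))) := 
    (eval_comp_of_eq hcm').trans (hcd A _)
  have hp : (ci.pair (cd.comp cm)).eval A (encode a) =
      Part.some (encode (a, ks.map fun p => digitValue A p.1 p.2 (m a))) := 
    eval_pair_of_eq hci' hd
  exact eval_comp_of_eq hp

end OracleCode

/-! ### Self-delimiting hints -/

/-- A self-delimiting form of a binary string. -/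
def selfDelim (β : List Bool) : List Bool :=
  β.foldr (fun b s => true :: b :: s) [false]

theorem length_selfDelim (β : List Bool) : (selfDelim β).length = 2 * β.length + 1 := by
  induction β with
  | nil => rfl
  | cons b β ih => simp only [selfDelim, List.foldr_cons, List.length_cons] at ih ⊢; omega

/-- Each bit is announced by `true` and the end by `false`, so a reader knows where `β` stops
without seeing what follows. -/
theorem selfDelim_append_prefix {β β' ρ ρ' : List Bool}
    (h : selfDelim β ++ ρ <+: selfDelim β' ++ ρ') : β = β' ∧ ρ <+: ρ' := by
  induction β generalizing β' with
  | nil => cases β' <;> simp_all [selfDelim]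
  | cons b β ih =>
    cases β' with
    | nil => simp [selfDelim] at h
    | cons b' β' =>
      simp only [selfDelim, List.foldr_cons, List.cons_append, List.cons_prefix_cons] at h
      obtain ⟨h1, h2⟩ := ih h.2.2
      exact ⟨by rw [h.2.1, h1], h2⟩

theorem primrec_selfDelim : Primrec selfDelim :=
  Primrec.list_foldr Primrec.id (Primrec.const _)
    (Primrec.list_cons.comp (Primrec.const true)
      (Primrec.list_cons.comp (Primrec.fst.comp Primrec.snd) (Primrec.snd.comp Primrec.snd))).to₂

/-- Splits a string into a self-delimiting prefix and the rest. -/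
def parseSelfDelim (π : List Bool) : Part (List Bool × List Bool) :=
  Nat.rfindOpt fun s => (decode (α := List Bool × List Bool) s).bind fun p =>
    if selfDelim p.1 ++ p.2 = π then some p else none

/-- The search returns some splitting of `π`, and `selfDelim_append_prefix` shows that there is only
one. -/
theorem mem_parseSelfDelim {π : List Bool} {p : List Bool × List Bool} :
    p ∈ parseSelfDelim π ↔ selfDelim p.1 ++ p.2 = π := by
  have key : ∀ p ∈ parseSelfDelim π, selfDelim p.1 ++ p.2 = π := by
    intro p hp
    obtain ⟨s, hs⟩ := Nat.rfindOpt_spec hp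
    simp only [Option.mem_def, Option.bind_eq_some_iff] at hs
    obtain ⟨q, -, hq⟩ := hs
    split_ifs at hq with h
    · obtain rfl := Option.some.inj hq
      exact h
  refine ⟨key p, fun h => ?_⟩
  have hdom : (parseSelfDelim π).Dom := by
    refine Nat.rfindOpt_dom.2 ⟨encode p, p, ?_⟩
    simp [h]
  obtain ⟨q, hq⟩ := Part.dom_iff_mem.1 hdom
  have h' := key q hq
  have hpq : selfDelim p.1 ++ p.2 <+: selfDelim q.1 ++ q.2 := by rw [h, h']
  obtain ⟨h1, h2⟩ := selfDelim_append_prefix hpq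
  have h3 : p.2 = q.2 := by
    rw [← h', h1] at h
    exact List.append_cancel_left h
  rwa [Prod.ext h1 h3]

theorem partrec_parseSelfDelim : Partrec parseSelfDelim := by
  refine Partrec.rfindOpt (Primrec.to_comp ?_)
  refine Primrec.option_bind (Primrec.decode.comp Primrec.snd) ?_
  exact Primrec.ite (Primrec.eq.comp
    (Primrec.list_append.comp (primrec_selfDelim.comp (Primrec.fst.comp Primrec.snd))
      (Primrec.snd.comp Primrec.snd)) (Primrec.fst.comp Primrec.fst))
    (Primrec.option_some.comp Primrec.snd) (Primrec.const none)

/-- The number with the given binary digits, least significant digit first. -/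
def binaryValue (ρ : List Bool) : ℕ :=
  ρ.foldr (fun b s => 2 * s + b.toNat) 0

theorem primrec_binaryValue : Primrec binaryValue :=
  Primrec.list_foldr Primrec.id (Primrec.const _)
    (Primrec.nat_add.comp (Primrec.nat_double.comp (Primrec.snd.comp Primrec.snd))
      ((Primrec.dom_bool Bool.toNat).comp (Primrec.fst.comp Primrec.snd))).to₂

/-- Padding by zeros gives strings of length exactly `L`; strings of one fixed length are
automatically prefix-free. -/
theorem exists_binaryValue_eq {L i : ℕ} (hi : i < 2 ^ L) :
    ∃ ρ : List Bool, ρ.length = L ∧ binaryValue ρ = i := by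
  induction L generalizing i with
  | zero => exact ⟨[], rfl, by simp [binaryValue]; omega⟩
  | succ L ih =>
    obtain ⟨ρ, h1, h2⟩ := ih (i := i / 2) (by rw [pow_succ] at hi; omega)
    refine ⟨decide (i % 2 = 1) :: ρ, by simp [h1], ?_⟩
    have h3 : binaryValue (decide (i % 2 = 1) :: ρ) =
      2 * binaryValue ρ + (decide (i % 2 = 1)).toNat := rfl
    rw [h3, h2]
    rcases Nat.mod_two_eq_zero_or_one i with h | h <;> simp [h] <;> omega

/-! ### Upper bounds on complexity -/

/-- The front end `F` reads a hint `h` and a string `ρ`; the back end `B` turns its result into the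
output. Together they give programs that are longer than `ρ` by about twice the length of `h`. -/
theorem OracleCode.IsUniversalPrefixFree.exists_condComplexity_le {U : OracleCode}
    (hU : U.IsUniversalPrefixFree) {η α : Type*} [Primcodable η] [Primcodable α]
    {F : (η × List Bool) × ℕ →. α} (hF : Partrec F)
    (hpf : ∀ h y ρ ρ', (F ((h, ρ), y)).Dom → (F ((h, ρ'), y)).Dom → ρ <+: ρ' → ρ = ρ')
    (B : OracleCode) :
    ∃ c : ℕ, ∀ (A : Set ℕ) (h : η) (ρ : List Bool) (y : ℕ) (a : α) (x : ℕ),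
      a ∈ F ((h, ρ), y) → x ∈ B.eval A (encode a) →
      ∃ π : List Bool, x ∈ U.run A π y ∧ π.length ≤ 2 * Nat.size (encode h) + ρ.length + c := by
  -- A program is `selfDelim β ++ ρ`, where `β` spells the code of the hint in binary; the doubling
  -- in `selfDelim` is the factor `2` in the bound.
  have hE : Partrec fun q : List Bool × ℕ => (parseSelfDelim q.1).bind fun p =>
      (Part.ofOption (decode (α := η) (binaryValue p.1))).bind fun h => F ((h, p.2), q.2) := by
    refine (partrec_parseSelfDelim.comp Computable.fst).bind ?_
    refine Partrec.bind (Computable.ofOption ?_) ?_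
    · exact Computable.decode.comp
        (primrec_binaryValue.to_comp.comp (Computable.fst.comp Computable.snd))
    · exact hF.comp (Computable.pair (Computable.pair Computable.snd
        (Computable.snd.comp (Computable.snd.comp Computable.fst)))
        (Computable.snd.comp (Computable.fst.comp Computable.fst)))
  obtain ⟨cE, hcE⟩ := OracleCode.exists_eval_eq_of_partrec hE
  have hrun : ∀ (A : Set ℕ) (π : List Bool) (y x : ℕ), x ∈ (B.comp cE).run A π y ↔
      ∃ p : List Bool × List Bool, selfDelim p.1 ++ p.2 = π ∧ ∃ h, decode (α := η) (binaryValue p.1) = some h ∧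
        ∃ a ∈ F ((h, p.2), y), x ∈ B.eval A (encode a) := by
    intro A π y x
    rw [OracleCode.run, OracleCode.eval_comp_apply, hcE]
    constructor
    · intro hx
      obtain ⟨v, hv, hx⟩ := Part.mem_bind_iff.1 hx
      obtain ⟨a, ha, rfl⟩ := (Part.mem_map_iff _).1 hv
      obtain ⟨p, hp, ha⟩ := Part.mem_bind_iff.1 ha
      obtain ⟨h, hh, ha⟩ := Part.mem_bind_iff.1 ha
      exact ⟨p, mem_parseSelfDelim.1 hp, h, Part.mem_ofOption.1 hh, a, ha, hx⟩
    · rintro ⟨p, hp, h, hh, a, ha, hx⟩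
      exact Part.mem_bind_iff.2 ⟨_, (Part.mem_map_iff _).2 ⟨a, Part.mem_bind_iff.2
        ⟨p, mem_parseSelfDelim.2 hp, Part.mem_bind_iff.2 ⟨h, Part.mem_ofOption.2 hh, ha⟩⟩, rfl⟩,
        hx⟩
  -- Only `F` matters here, since `B` can but shrink the domain: comparable programs share `β`,
  -- hence the hint, and `hpf` applies to the remainders.
  have hM : (B.comp cE).IsPrefixFree := by
    intro A y π π' hd hd' hπ
    obtain ⟨x, hx⟩ := Part.dom_iff_mem.1 hd
    obtain ⟨x', hx'⟩ := Part.dom_iff_mem.1 hd'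
    obtain ⟨p, hp, h, hh, a, ha, -⟩ := (hrun A π y x).1 hx
    obtain ⟨p', hp', h', hh', a', ha', -⟩ := (hrun A π' y x').1 hx'
    rw [← hp, ← hp'] at hπ
    obtain ⟨h1, h2⟩ := selfDelim_append_prefix hπ
    rw [h1, hh'] at hh
    obtain rfl := Option.some.inj hh
    have := hpf _ _ _ _ (Part.dom_iff_mem.2 ⟨a, ha⟩) (Part.dom_iff_mem.2 ⟨a', ha'⟩) h2
    rw [← hp, ← hp', h1, this]
  obtain ⟨c, hc⟩ := hU.2 _ hM
  -- The extra `1` is the end marker of `selfDelim β`.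
  refine ⟨c + 1, fun A h ρ y a x ha hx => ?_⟩
  obtain ⟨β, hβ, hβ'⟩ := exists_binaryValue_eq (Nat.lt_size_self (encode h))
  obtain ⟨π, h1, h2⟩ := hc A (selfDelim β ++ ρ) y x
    ((hrun _ _ _ _).2 ⟨(β, ρ), rfl, h, by rw [hβ', encodek], a, ha, hx⟩)
  refine ⟨π, h1, h2.trans ?_⟩
  rw [List.length_append, length_selfDelim, hβ]
  omega

theorem condComplexity_le_of_mem_run {α β : Type*} [Encodable α] [Encodable β] {U : OracleCode}
    {A : Set ℕ} {σ : α} {τ : β} {π : List Bool} {c : ℕ}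
    (h : encode σ ∈ U.run A π (encode τ)) (hc : π.length ≤ c) :
    condComplexity U A σ τ ≤ c :=
  (iInf₂_le π h).trans (by exact_mod_cast hc)

/-! ### Enumerations without repetition -/

section Enumeration

variable {α β : Type*}

/-- The value `f a j` is listed at stage `j` and at no earlier stage. -/
def FirstListed (f : α → ℕ → Option β) (a : α) (j : ℕ) : Prop :=
  f a j ≠ none ∧ ∀ j' < j, f a j' ≠ f a j

open Classical in
/-- The `i`-th element of the enumeration without repetition of the values of `f a`. -/
noncomputable def listedAt (f : α → ℕ → Option β) (q : α × ℕ) : Part β :=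
  Nat.rfindOpt fun j =>
    if FirstListed f q.1 j ∧ Nat.count (FirstListed f q.1) j = q.2 then f q.1 j else none

open Classical in
theorem partrec_listedAt [Primcodable α] [Primcodable β] {f : α → ℕ → Option β} (hf : Primrec₂ f) : Partrec (listedAt f) := by
  have hrel : PrimrecRel fun (j : ℕ) (a : α) => FirstListed f a j := by
    have h1 : PrimrecRel fun (j' : ℕ) (q : ℕ × α) => f q.2 j' ≠ f q.2 q.1 :=
      (Primrec.eq.comp (hf.comp (Primrec.snd.comp Primrec.snd) Primrec.fst)
        (hf.comp (Primrec.snd.comp Primrec.snd) (Primrec.fst.comp Primrec.snd))).not.primrecRel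
    have h2 : PrimrecPred fun q : ℕ × α => ∀ j' < q.1, f q.2 j' ≠ f q.2 q.1 :=
      ((PrimrecRel.forall_mem_list h1).comp (Primrec.list_range.comp Primrec.fst)
        Primrec.id).of_eq fun q => by simp
    exact PrimrecPred.primrecRel ((Primrec.eq.comp (hf.comp Primrec.snd Primrec.fst)
      (Primrec.const none)).not.and h2)
  have hcount : Primrec₂ fun (j : ℕ) (a : α) => Nat.count (FirstListed f a) j := by
    refine (Primrec.list_length.comp
      ((PrimrecRel.listFilter hrel).comp (Primrec.list_range.comp Primrec.fst) Primrec.snd)).of_eq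
      fun q => ?_
    exact List.countP_eq_length_filter.symm
  refine Partrec.rfindOpt (Primrec.to_comp ?_)
  refine Primrec.ite (PrimrecPred.and
    (hrel.comp Primrec.snd (Primrec.fst.comp Primrec.fst))
    (Primrec.eq.comp (hcount.comp Primrec.snd (Primrec.fst.comp Primrec.fst))
      (Primrec.snd.comp Primrec.fst))) ?_ (Primrec.const none)
  exact hf.comp (Primrec.fst.comp Primrec.fst) Primrec.snd

variable {f : α → ℕ → Option β} {a : α} {i : ℕ}

open Classical in
theorem mem_listedAt {y : β} : y ∈ listedAt f (a, i) ↔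
    ∃ j, FirstListed f a j ∧ Nat.count (FirstListed f a) j = i ∧ f a j = some y := by
  have key : ∀ y ∈ listedAt f (a, i), ∃ j, FirstListed f a j ∧
      Nat.count (FirstListed f a) j = i ∧ f a j = some y := by
    intro y hy
    obtain ⟨j, hj⟩ := Nat.rfindOpt_spec hy
    split_ifs at hj with h
    · exact ⟨j, h.1, h.2, hj⟩
    · simp at hj
  refine ⟨key y, fun ⟨j, h1, h2, h3⟩ => ?_⟩
  have hdom : (listedAt f (a, i)).Dom :=
    Nat.rfindOpt_dom.2 ⟨j, y, by simp only [h1, h2, h3, and_self, if_true]; rfl⟩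
  obtain ⟨y', hy'⟩ := Part.dom_iff_mem.1 hdom
  obtain ⟨j', h1', h2', h3'⟩ := key y' hy'
  obtain rfl : j = j' := Nat.count_injective h1 h1' (h2.trans h2'.symm)
  obtain rfl : y = y' := Option.some.inj (h3.symm.trans h3')
  exact hy'

theorem exists_mem_listedAt {y : β} (h : ∃ j, f a j = some y) : ∃ i, y ∈ listedAt f (a, i) := by
  classical
  obtain ⟨j, hj, hmin⟩ := Nat.find_spec h, Nat.find_spec h, fun m hm => Nat.find_min h (m := m) hm
  refine ⟨_, mem_listedAt.2 ⟨Nat.find h, ⟨by rw [hj]; simp, fun j' hj' he => ?_⟩, rfl, hj⟩⟩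
  exact hmin j' hj' (he.trans hj)

/-- When the index `i` is reached, the stages of first listing so far carry `i + 1` distinct values.
-/
theorem lt_ncard_of_dom_listedAt (hfin : {y | ∃ j, f a j = some y}.Finite)
    (h : (listedAt f (a, i)).Dom) : i < {y | ∃ j, f a j = some y}.ncard := by
  classical
  obtain ⟨y, hy⟩ := Part.dom_iff_mem.1 h
  obtain ⟨j, h1, h2, h3⟩ := mem_listedAt.1 hy
  have hc : Nat.count (FirstListed f a) (j + 1) = i + 1 := by
    rw [Nat.count_succ, if_pos h1, h2]
  rw [Nat.count_eq_card_filter_range] at hc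
  rw [← Nat.add_one_le_iff, ← hc, ← Set.ncard_image_of_injective _ (Option.some_injective β),
    ← Set.ncard_coe_finset]
  refine Set.ncard_le_ncard_of_injOn (f a) ?_ ?_ (hfin.image _)
  · intro j' hj'
    simp only [Finset.coe_filter, Set.mem_ofPred_eq] at hj'
    obtain ⟨y', hy'⟩ := Option.ne_none_iff_exists'.1 hj'.2.1
    exact ⟨y', ⟨j', hy'⟩, hy'.symm⟩
  · intro j₁ h₁ j₂ h₂ he
    simp only [Finset.coe_filter, Set.mem_ofPred_eq] at h₁ h₂
    rcases lt_trichotomy j₁ j₂ with hlt | heq | hlt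
    · exact absurd he (h₂.2.2 j₁ hlt)
    · exact heq
    · exact absurd he.symm (h₁.2.2 j₂ hlt)

/-- The count of first listings grows by at most one per stage, so it passes through every smaller
index. -/
theorem dom_listedAt_of_le {i' : ℕ} (hi : i' ≤ i) (h : (listedAt f (a, i)).Dom) :
    (listedAt f (a, i')).Dom := by
  classical
  obtain ⟨y, hy⟩ := Part.dom_iff_mem.1 h
  obtain ⟨j, h1, h2, -⟩ := mem_listedAt.1 hy
  have key : ∀ j, i' < Nat.count (FirstListed f a) j →
      ∃ j', FirstListed f a j' ∧ Nat.count (FirstListed f a) j' = i' := by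
    intro j
    induction j with
    | zero => simp
    | succ j ih =>
      intro hlt
      rw [Nat.count_succ] at hlt
      by_cases hlt' : i' < Nat.count (FirstListed f a) j
      · exact ih hlt'
      · split_ifs at hlt with hj
        · exact ⟨j, hj, by omega⟩
        · omega
  obtain ⟨j', h1', h2'⟩ := key (j + 1) (by rw [Nat.count_succ, if_pos h1]; omega)
  obtain ⟨y', hy'⟩ := Option.ne_none_iff_exists'.1 h1'.1
  exact Part.dom_iff_mem.2 ⟨y', mem_listedAt.2 ⟨j', h1', h2', hy'⟩⟩

/-- If the index `i` were never reached, sending each value to its index would inject all values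
into `{0, ..., i - 1}`. -/
theorem dom_listedAt_of_lt_ncard (h : i < {y | ∃ j, f a j = some y}.ncard) :
    (listedAt f (a, i)).Dom := by
  by_contra hdom
  have hex : ∀ y ∈ {y | ∃ j, f a j = some y}, ∃ i' < i, y ∈ listedAt f (a, i') := by
    intro y hy
    obtain ⟨i', hi'⟩ := exists_mem_listedAt hy
    refine ⟨i', ?_, hi'⟩
    by_contra hle
    exact hdom (dom_listedAt_of_le (not_lt.1 hle) (Part.dom_iff_mem.2 ⟨y, hi'⟩))
  choose! g hg hg' using hex
  have := Set.ncard_le_ncard_of_injOn (t := ↑(Finset.range i)) g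
    (fun y hy => by simpa using hg y hy)
    (fun y hy y' hy' he => Part.mem_unique (hg' y hy) (he ▸ hg' y' hy')) (Finset.finite_toSet _)
  rw [Set.ncard_coe_finset, Finset.card_range] at this
  omega

end Enumeration

/-! ### Splitting the information in a string -/

/-- The condition `0` is the code of the empty string, as in `complexity`, and each program has at
most one output. -/
theorem finite_outputs_and_ncard_le (U : OracleCode) (ℓ : ℕ) :
    {w | ∃ π : List Bool, π.length = ℓ ∧ w ∈ U.run ∅ π 0}.Finite ∧
      {w | ∃ π : List Bool, π.length = ℓ ∧ w ∈ U.run ∅ π 0}.ncard ≤ 2 ^ ℓ := by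
  classical
  let g : List.Vector Bool ℓ → ℕ := fun v =>
    if h : ∃ w, w ∈ U.run ∅ v.1 0 then h.choose else 0
  have hsub : {w | ∃ π : List Bool, π.length = ℓ ∧ w ∈ U.run ∅ π 0} ⊆ Set.range g := by
    rintro w ⟨π, hπ, hw⟩
    refine ⟨⟨π, hπ⟩, ?_⟩
    have h : ∃ w, w ∈ U.run ∅ π 0 := ⟨w, hw⟩
    simp only [g, dif_pos h]
    exact Part.mem_unique h.choose_spec hw
  have hfin := Set.finite_range g
  refine ⟨hfin.subset hsub, (Set.ncard_le_ncard hsub hfin).trans ?_⟩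
  rw [← Set.image_univ]
  refine (Set.ncard_image_le Set.finite_univ).trans ?_
  rw [Set.ncard_univ, Nat.card_eq_fintype_card, card_vector, Fintype.card_bool]

section Splitting

variable {X : Type*}

open Classical in
/-- The outputs `w` of programs of length `ℓ` with feature `tr d w = x`, with repetitions, where
`a = ((d, ℓ), x)`. -/
noncomputable def outputWithFeature (cU : Nat.Partrec.Code) (tr : ℕ → ℕ → X) (a : (ℕ × ℕ) × X)
    (j : ℕ) : Option ℕ :=
  (decode (α := List Bool × ℕ) j).bind fun p =>
    (Nat.Partrec.Code.evaln p.2 cU (Nat.pair (encode p.1) 0)).bind fun w =>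
      if p.1.length = a.1.2 ∧ tr a.1.1 w = a.2 then some w else none

theorem primrec_evaln_const (c : Nat.Partrec.Code) :
    Primrec₂ fun s a : ℕ => Nat.Partrec.Code.evaln s c a :=
  Nat.Partrec.Code.primrec_evaln.comp
    (Primrec.pair (Primrec.pair Primrec.fst (Primrec.const c)) Primrec.snd)

theorem primrec_outputWithFeature [Primcodable X] (cU : Nat.Partrec.Code) {tr : ℕ → ℕ → X}
    (htr : Primrec₂ tr) : Primrec₂ (outputWithFeature cU tr) := by
  classical
  refine Primrec.option_bind (Primrec.decode.comp Primrec.snd) ?_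
  refine Primrec.option_bind ((primrec_evaln_const cU).comp (Primrec.snd.comp Primrec.snd)
    (Primrec₂.natPair.comp (Primrec.encode.comp (Primrec.fst.comp Primrec.snd))
      (Primrec.const 0))) ?_
  have ha : Primrec fun q : ((((ℕ × ℕ) × X) × ℕ) × List Bool × ℕ) × ℕ => q.1.1.1 :=
    Primrec.fst.comp (Primrec.fst.comp Primrec.fst)
  exact Primrec.ite (PrimrecPred.and
    (Primrec.eq.comp (Primrec.list_length.comp (Primrec.fst.comp (Primrec.snd.comp Primrec.fst)))
      (Primrec.snd.comp (Primrec.fst.comp ha)))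
    (Primrec.eq.comp (htr.comp (Primrec.fst.comp (Primrec.fst.comp ha)) Primrec.snd)
      (Primrec.snd.comp ha))) (Primrec.option_some.comp Primrec.snd) (Primrec.const none)

theorem exists_outputWithFeature_eq {U : OracleCode} {cU : Nat.Partrec.Code}
    (hcU : cU.eval = U.eval ∅) (tr : ℕ → ℕ → X) (d ℓ : ℕ) (x : X) (w : ℕ) :
    (∃ j, outputWithFeature cU tr ((d, ℓ), x) j = some w) ↔
      (∃ π : List Bool, π.length = ℓ ∧ w ∈ U.run ∅ π 0) ∧ tr d w = x := by
  have hrun : ∀ π : List Bool, w ∈ U.run ∅ π 0 ↔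
      ∃ s, w ∈ Nat.Partrec.Code.evaln s cU (Nat.pair (encode π) 0) := by
    intro π
    rw [← Nat.Partrec.Code.evaln_complete, hcU]
    rfl
  constructor
  · rintro ⟨j, hj⟩
    simp only [outputWithFeature, Option.bind_eq_some_iff] at hj
    obtain ⟨p, -, w', hw', hj⟩ := hj
    split_ifs at hj with h
    obtain rfl := Option.some.inj hj
    exact ⟨⟨p.1, h.1, (hrun _).2 ⟨p.2, hw'⟩⟩, h.2⟩
  · rintro ⟨⟨π, hπ, hw⟩, htr⟩
    obtain ⟨s, hs⟩ := (hrun π).1 hw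
    refine ⟨encode (π, s), ?_⟩
    rw [outputWithFeature, encodek, Option.bind_some, Option.mem_def.1 hs, Option.bind_some,
      if_pos ⟨hπ, htr⟩]

/-- The features shared by at least `2 ^ k` outputs of programs of length `ℓ`, with repetitions,
where `b = ((d, ℓ), k)` and `cE` enumerates the outputs with a given feature. -/
def frequentFeature [Primcodable X] (cE : Nat.Partrec.Code) (b : (ℕ × ℕ) × ℕ) (j : ℕ) : Option X :=
  (decode (α := X × ℕ) j).bind fun p =>
    -- Indices start at `0`, so there are at least `2 ^ k` outputs exactly when the index `2 ^ k -
    -- 1` is reached. This can be confirmed in finite time, here within `p.2` steps.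
    (Nat.Partrec.Code.evaln p.2 cE (encode ((b.1, p.1), 2 ^ b.2 - 1))).bind fun _ => some p.1

theorem primrec_frequentFeature [Primcodable X] (cE : Nat.Partrec.Code) :
    Primrec₂ (frequentFeature (X := X) cE) := by
  refine Primrec.option_bind (Primrec.decode.comp Primrec.snd) ?_
  refine Primrec.option_bind ((primrec_evaln_const cE).comp (Primrec.snd.comp Primrec.snd)
    (Primrec.encode.comp ?_)) ?_
  · have hb : Primrec fun q : (((ℕ × ℕ) × ℕ) × ℕ) × X × ℕ => q.1.1 :=
      Primrec.fst.comp Primrec.fst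
    exact Primrec.pair (Primrec.pair (Primrec.fst.comp hb) (Primrec.fst.comp Primrec.snd))
      (Primrec.nat_sub.comp (Primrec.two_pow.comp (Primrec.snd.comp hb)) (Primrec.const 1))
  · exact Primrec.option_some.comp (Primrec.fst.comp (Primrec.snd.comp Primrec.fst))

theorem exists_frequentFeature_eq [Primcodable X] {cE : Nat.Partrec.Code} {E : ((ℕ × ℕ) × X) × ℕ →. ℕ}
    (hcE : ∀ q, cE.eval (encode q) = E q) (b : ℕ × ℕ) (k : ℕ) (x : X) :
    (∃ j, frequentFeature cE (b, k) j = some x) ↔ (E ((b, x), 2 ^ k - 1)).Dom := by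
  have hdom : (E ((b, x), 2 ^ k - 1)).Dom ↔
      ∃ s w, w ∈ Nat.Partrec.Code.evaln s cE (encode ((b, x), 2 ^ k - 1)) := by
    rw [exists_comm, Part.dom_iff_mem]
    refine exists_congr fun w => ?_
    rw [← Nat.Partrec.Code.evaln_complete, hcE]
  rw [hdom]
  constructor
  · rintro ⟨j, hj⟩
    simp only [frequentFeature, Option.bind_eq_some_iff] at hj
    obtain ⟨p, -, w, hw, hp⟩ := hj
    obtain rfl := Option.some.inj hp
    exact ⟨p.2, w, hw⟩
  · rintro ⟨s, w, hw⟩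
    refine ⟨encode (x, s), ?_⟩
    rw [frequentFeature, encodek, Option.bind_some, Option.mem_def.1 hw, Option.bind_some]

end Splitting

/-- The fibres are disjoint subsets of `S`, so at most `2 ^ ℓ / 2 ^ k` of them can have `2 ^ k`
elements. -/
theorem ncard_large_fibers_le {X : Type*} {S : Set ℕ} (hS : S.Finite) (g : ℕ → X) {ℓ k : ℕ}
    (hcard : S.ncard ≤ 2 ^ ℓ) (hk : k ≤ ℓ) :
    {x | 2 ^ k ≤ {w ∈ S | g w = x}.ncard}.Finite ∧
      {x | 2 ^ k ≤ {w ∈ S | g w = x}.ncard}.ncard ≤ 2 ^ (ℓ - k) := by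
  classical
  have hpos : 0 < 2 ^ k := by positivity
  have hfin : {x | 2 ^ k ≤ {w ∈ S | g w = x}.ncard}.Finite := by
    refine (hS.image g).subset fun x hx => ?_
    obtain ⟨w, hw, rfl⟩ :=
      (Set.ncard_pos (hS.subset (Set.sep_subset S fun w => g w = x))).1 (hpos.trans_le hx)
    exact ⟨w, hw, rfl⟩
  refine ⟨hfin, ?_⟩
  have hsum : 2 ^ k * hfin.toFinset.card ≤ hS.toFinset.card := by
    have h1 : hfin.toFinset.card • 2 ^ k ≤
        ∑ x ∈ hfin.toFinset, (hS.toFinset.filter fun w => g w = x).card := by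
      refine Finset.card_nsmul_le_sum _ _ _ fun x hx => ?_
      rw [← Set.ncard_coe_finset]
      simpa using hx
    rw [smul_eq_mul, mul_comm] at h1
    exact h1.trans ((Finset.sum_card_fiberwise_eq_card_filter hS.toFinset hfin.toFinset g).trans_le
      (Finset.card_filter_le _ _))
  rw [← Set.ncard_eq_toFinset_card _ hfin, ← Set.ncard_eq_toFinset_card _ hS] at hsum
  have h2 : 2 ^ k * 2 ^ (ℓ - k) = 2 ^ ℓ := by rw [← pow_add]; congr 1; omega
  refine Nat.le_of_mul_le_mul_left ?_ hpos
  rw [h2]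
  exact hsum.trans hcard

/-- A string `w` with a program of length `ℓ`, together with a feature `tr d w` of `w`, can be
described in two parts: `ℓ - k` bits for the feature, and `k + 1` bits for `w` given the feature. -/
theorem exists_two_part_description (U : OracleCode) {X : Type*} [Primcodable X]
    {tr : ℕ → ℕ → X} (htr : Primrec₂ tr) :
    ∃ (E : ((ℕ × ℕ) × X) × ℕ →. ℕ) (E' : ((ℕ × ℕ) × ℕ) × ℕ →. X), Partrec E ∧ Partrec E' ∧
      ∀ (d ℓ w : ℕ), (∃ π : List Bool, π.length = ℓ ∧ w ∈ U.run ∅ π 0) →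
        ∃ k ≤ ℓ, (∃ i < 2 ^ (k + 1), w ∈ E (((d, ℓ), tr d w), i)) ∧
          ∃ i < 2 ^ (ℓ - k), tr d w ∈ E' (((d, ℓ), k), i) := by
  obtain ⟨cU, hcU⟩ := Nat.Partrec.Code.exists_code.1 U.partrec_eval_empty
  set f := outputWithFeature cU tr with hfdef
  have hf : Partrec (listedAt f) := partrec_listedAt (primrec_outputWithFeature cU htr)
  obtain ⟨cE, hcE⟩ := Nat.Partrec.Code.exists_code.1 hf
  have hcE' : ∀ q, (cE).eval (encode q) = listedAt f q := by
    intro q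
    rw [hcE]
    simp only [encodek]
    exact (Part.bind_some _ _).trans (Part.map_id' (fun _ => rfl) _)
  have hf'mem := exists_frequentFeature_eq hcE'
  set f' : (ℕ × ℕ) × ℕ → ℕ → Option X := frequentFeature cE with hf'def
  refine ⟨listedAt f, listedAt f', hf, partrec_listedAt (primrec_frequentFeature cE), ?_⟩
  intro d ℓ w hw
  obtain ⟨hfin, hcard⟩ := finite_outputs_and_ncard_le U ℓ
  set S := {w | ∃ π : List Bool, π.length = ℓ ∧ w ∈ U.run ∅ π 0} with hS
  have hSx : ∀ x, {w | ∃ j, f ((d, ℓ), x) j = some w} = {w ∈ S | tr d w = x} := by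
    intro x
    ext w
    exact exists_outputWithFeature_eq hcU tr d ℓ x w
  have hfinx : ∀ x, {w ∈ S | tr d w = x}.Finite := fun x => hfin.subset (Set.sep_subset _ _)
  set N := {w' ∈ S | tr d w' = tr d w}.ncard with hN
  have hNpos : 0 < N := (Set.ncard_pos (hfinx _)).2 ⟨w, hw, rfl⟩
  have hNle : N ≤ 2 ^ ℓ := (Set.ncard_le_ncard (Set.sep_subset _ _) hfin).trans hcard
  -- This `k` balances the two parts: the fibre of `w` has fewer than `2 ^ (k + 1)` elements to
  -- index, and at least `2 ^ k`, so few features compete with its own.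
  set k := Nat.log 2 N with hk
  have hkN : 2 ^ k ≤ N := Nat.pow_log_le_self 2 hNpos.ne'
  have hNk : N < 2 ^ (k + 1) := Nat.lt_pow_succ_log_self (by norm_num) N
  have hkℓ : k ≤ ℓ := (Nat.pow_le_pow_iff_right (by norm_num : 1 < 2)).1 (hkN.trans hNle)
  have hpos : 0 < 2 ^ k := by positivity
  refine ⟨k, hkℓ, ?_, ?_⟩
  · obtain ⟨i, hi⟩ := exists_mem_listedAt (f := f) (a := ((d, ℓ), tr d w)) (y := w)
      ((exists_outputWithFeature_eq hcU tr d ℓ (tr d w) w).2 ⟨hw, rfl⟩)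
    refine ⟨i, lt_trans ?_ hNk, hi⟩
    have := lt_ncard_of_dom_listedAt (by rw [hSx]; exact hfinx _) (Part.dom_iff_mem.2 ⟨w, hi⟩)
    rwa [hSx] at this
  · have hX : {x | ∃ j, f' ((d, ℓ), k) j = some x} =
        {x | 2 ^ k ≤ {w' ∈ S | tr d w' = x}.ncard} := by
      ext x
      rw [Set.mem_ofPred_eq, hf'mem, Set.mem_ofPred_eq]
      constructor
      · intro h
        have := lt_ncard_of_dom_listedAt (by rw [hSx]; exact hfinx _) h
        rw [hSx] at this
        omega
      · intro h
        refine dom_listedAt_of_lt_ncard ?_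
        rw [hSx]
        omega
    obtain ⟨hXfin, hXcard⟩ := ncard_large_fibers_le hfin (tr d) hcard hkℓ
    obtain ⟨i, hi⟩ := exists_mem_listedAt (f := f') (a := ((d, ℓ), k)) (y := tr d w)
      (by have h : tr d w ∈ {x | ∃ j, f' ((d, ℓ), k) j = some x} := by rw [hX]; exact hkN
          exact h)
    refine ⟨i, lt_of_lt_of_le ?_ hXcard, hi⟩
    have := lt_ncard_of_dom_listedAt (by rw [hX]; exact hXfin) (Part.dom_iff_mem.2 ⟨_, hi⟩)
    rwa [hX] at this

/-! ### Programs with an index of known length -/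

/-- The hint determines the length of the index, so the index needs no self-delimiting form and
costs just `len h` bits. Only the hint, of logarithmic size in the applications, is paid for twice.
-/
theorem OracleCode.IsUniversalPrefixFree.exists_program_of_index {U : OracleCode}
    (hU : U.IsUniversalPrefixFree) {η α : Type*} [Primcodable η] [Primcodable α]
    {G : (η × ℕ) × ℕ →. α} (hG : Partrec G) {len : η → ℕ} (hlen : Primrec len)
    (B : OracleCode) :
    ∃ c : ℕ, ∀ (A : Set ℕ) (h : η) (i y : ℕ) (a : α) (x : ℕ), i < 2 ^ len h →
      a ∈ G ((h, i), y) → x ∈ B.eval A (encode a) →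
      ∃ π : List Bool, x ∈ U.run A π y ∧ π.length ≤ 2 * Nat.size (encode h) + len h + c := by
  classical
  let g : (η × List Bool) × ℕ → Option Unit := fun q =>
    if q.1.2.length = len q.1.1 then some () else none
  have hg : Primrec g :=
    Primrec.ite (Primrec.eq.comp (Primrec.list_length.comp (Primrec.snd.comp Primrec.fst))
      (hlen.comp (Primrec.fst.comp Primrec.fst))) (Primrec.const _) (Primrec.const none)
  let F : (η × List Bool) × ℕ →. α := fun q =>
    (Part.ofOption (g q)).bind fun _ => G ((q.1.1, binaryValue q.1.2), q.2)
  have hF : Partrec F := by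
    refine (Computable.ofOption hg.to_comp).bind (hG.comp (Primrec.to_comp ?_))
    exact Primrec.pair (Primrec.pair (Primrec.fst.comp (Primrec.fst.comp Primrec.fst))
      (primrec_binaryValue.comp (Primrec.snd.comp (Primrec.fst.comp Primrec.fst))))
      (Primrec.snd.comp Primrec.fst)
  have hFlen : ∀ h y ρ, (F ((h, ρ), y)).Dom → ρ.length = len h := by
    intro h y ρ hd
    obtain ⟨a, ha⟩ := Part.dom_iff_mem.1 hd
    obtain ⟨u, hu, -⟩ := Part.mem_bind_iff.1 ha
    have hu' := Part.mem_ofOption.1 hu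
    by_contra hne
    simp [g, hne] at hu'
  obtain ⟨c, hc⟩ := hU.exists_condComplexity_le hF (fun h y ρ ρ' hd hd' hp =>
    hp.eq_of_length ((hFlen h y ρ hd).trans (hFlen h y ρ' hd').symm)) B
  refine ⟨c, fun A h i y a x hi ha hx => ?_⟩
  obtain ⟨ρ, hρ, rfl⟩ := exists_binaryValue_eq hi
  have := hc A h ρ y a x (Part.mem_bind_iff.2 ⟨(), Part.mem_ofOption.2 (by simp [g, hρ]), ha⟩) hx
  rwa [hρ] at this

/-! ### Rational vectors -/

section Vectors

variable {n : ℕ}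

/-- A point of the grid of mesh `2 ^ (-d)` whose coordinates have odd numerators. -/
def gridPoint (d : ℕ) (b : Fin n → ℤ) : Fin n → ℚ :=
  fun k => (2 * b k + 1 : ℤ) / (2 ^ (d + 1) : ℕ)

/-- An odd numerator is coprime to a power of two, so the fraction is already reduced and its data
are explicit. This is why the grid uses odd numerators. -/
theorem ratVecData_gridPoint (d : ℕ) (b : Fin n → ℤ) :
    ratVecData (gridPoint d b) = List.ofFn fun k => (2 * b k + 1, 2 ^ (d + 1)) := by
  unfold ratVecData
  congr 1
  funext k
  have hcop : Nat.Coprime (2 * b k + 1).natAbs (2 ^ (d + 1) : ℕ) := by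
    refine Nat.Coprime.pow_right _ ?_
    rw [Nat.coprime_two_right, Int.natAbs_odd]
    exact ⟨b k, rfl⟩
  have hpos : (0 : ℤ) < (2 ^ (d + 1) : ℕ) := by positivity
  have hcop' : Nat.Coprime (2 * b k + 1).natAbs ((2 ^ (d + 1) : ℕ) : ℤ).natAbs := by
    rwa [Int.natAbs_natCast]
  have h1 := Rat.num_div_eq_of_coprime hpos hcop'
  have h2 := Rat.den_div_eq_of_coprime hpos hcop'
  rw [Int.cast_natCast] at h1 h2
  exact Prod.ext h1 (Int.ofNat_inj.1 h2)

theorem primrec_ratVecData_gridPoint :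
    Primrec fun q : ℕ × (Fin n → ℤ) => ratVecData (gridPoint q.1 q.2) := by
  have h : Primrec fun q : ℕ × (Fin n → ℤ) =>
      List.ofFn fun k => (2 * q.2 k + 1, 2 ^ (q.1 + 1)) := by
    refine Primrec.list_ofFn fun k => Primrec.pair ?_ ?_
    · exact Primrec.int_add.comp (Primrec.int_mul.comp (Primrec.const 2)
        (Primrec.fin_apply Primrec.snd k)) (Primrec.const 1)
    · exact Primrec.two_pow.comp (Primrec.succ.comp Primrec.fst)
  exact h.of_eq fun q => (ratVecData_gridPoint q.1 q.2).symm

theorem Primrec.ratVecData_gridPoint {α : Type*} [Primcodable α] {d : α → ℕ}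
    {b : α → Fin n → ℤ} (hd : Primrec d) (hb : Primrec b) :
    Primrec fun a => ratVecData (gridPoint (d a) (b a)) :=
  Primrec.comp (f := fun q : ℕ × (Fin n → ℤ) => ratVecData (gridPoint q.1 q.2))
    primrec_ratVecData_gridPoint (Primrec.pair hd hb)

/-- The integer parts of the coordinates of a rational vector, scaled by `2 ^ d`. -/
def truncData (n d : ℕ) (l : List (ℤ × ℕ)) : Fin n → ℤ :=
  fun k => 2 ^ d * (l.getD k (0, 1)).1 / ((l.getD k (0, 1)).2 : ℤ)

theorem primrec_truncData : Primrec₂ (truncData n) := by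
  refine Primrec.fin_pi fun k => ?_
  have h : Primrec fun q : ℕ × List (ℤ × ℕ) => q.2.getD k (0, 1) :=
    (Primrec.list_getD (0, 1)).comp Primrec.snd (Primrec.const _)
  exact Primrec.int_ediv_nat.comp (Primrec.int_mul.comp (Primrec.int_two_pow.comp Primrec.fst)
    (Primrec.fst.comp h)) (Primrec.snd.comp h)

theorem truncData_ratVecData (d : ℕ) (p : Fin n → ℚ) :
    truncData n d (ratVecData p) = fun k => ⌊(2 : ℝ) ^ d * (p k : ℝ)⌋ := by
  funext k
  have h : (ratVecData p).getD k (0, 1) = ((p k).num, (p k).den) := by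
    rw [ratVecData, List.getD_eq_getElem _ _ (by simp)]
    simp
  rw [truncData, h, ← Rat.floor_intCast_div_natCast]
  have h2 : (((2 ^ d * (p k).num : ℤ) : ℚ) / ((p k).den : ℚ)) = 2 ^ d * p k := by
    push_cast
    rw [mul_div_assoc, Rat.num_div_den]
  rw [h2, ← Rat.floor_cast (α := ℝ)]
  push_cast
  rfl

/-- The number code of a rational vector, truncated. -/
def truncCode (n d w : ℕ) : Fin n → ℤ :=
  truncData n d ((decode (α := List (ℤ × ℕ)) w).getD [])

theorem primrec_truncCode : Primrec₂ (truncCode n) :=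
  primrec_truncData.comp Primrec.fst
    (Primrec.option_getD.comp (Primrec.decode.comp Primrec.snd) (Primrec.const []))

theorem truncCode_encode (d : ℕ) (p : Fin n → ℚ) :
    truncCode n d (encode (ratVecData p)) = fun k => ⌊(2 : ℝ) ^ d * (p k : ℝ)⌋ := by
  rw [truncCode, encodek, Option.getD_some, truncData_ratVecData]

theorem primrec_int_vec_add : Primrec₂ fun x y : Fin n → ℤ => x + y :=
  Primrec.fin_pi fun k => Primrec.int_add.comp (Primrec.fin_apply Primrec.fst k)
    (Primrec.fin_apply Primrec.snd k)

theorem primrec_int_vec_sub : Primrec₂ fun x y : Fin n → ℤ => x - y :=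
  Primrec.fin_pi fun k => Primrec.int_sub.comp (Primrec.fin_apply Primrec.fst k)
    (Primrec.fin_apply Primrec.snd k)

/-! ### Approximation by rational vectors -/

theorem norm_le_sum_abs (v : EuclideanSpace ℝ (Fin n)) : ‖v‖ ≤ ∑ k, |v k| := by
  rw [EuclideanSpace.norm_eq, Real.sqrt_le_left (Finset.sum_nonneg fun k _ => abs_nonneg _)]
  simp only [Real.norm_eq_abs]
  exact Finset.sum_sq_le_sq_sum_of_nonneg fun k _ => abs_nonneg _

theorem abs_apply_le_norm (v : EuclideanSpace ℝ (Fin n)) (k : Fin n) : |v k| ≤ ‖v‖ :=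
  PiLp.norm_apply_le v k

theorem abs_sub_lt_of_mem_ratBall {s : ℤ} {y : EuclideanSpace ℝ (Fin n)} {q : Fin n → ℚ}
    (hq : q ∈ ratBall s y) (k : Fin n) : |(q k : ℝ) - y k| < 2 ^ (-s) := by
  have h : ‖WithLp.toLp 2 (fun k => (q k : ℝ)) - y‖ < 2 ^ (-s) := by
    rw [← dist_eq_norm]; exact hq
  exact (abs_apply_le_norm (WithLp.toLp 2 (fun k => (q k : ℝ)) - y) k).trans_lt h

theorem mem_ratBall_of_sum_lt {s : ℤ} {y : EuclideanSpace ℝ (Fin n)} {q : Fin n → ℚ}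
    (h : ∑ k, |(q k : ℝ) - y k| < 2 ^ (-s)) : q ∈ ratBall s y := by
  change dist _ _ < _
  rw [dist_eq_norm]
  exact (norm_le_sum_abs _).trans_lt h

/-- The grid point is the midpoint of the dyadic cell that contains `x`, so the error is half the
mesh. -/
theorem abs_gridPoint_sub_le (d : ℕ) (x : ℝ) (b : Fin n → ℤ) (k : Fin n)
    (hb : b k = ⌊(2 : ℝ) ^ d * x⌋) : |(gridPoint d b k : ℝ) - x| ≤ (1 / 2) ^ (d + 1) := by
  have h1 := Int.floor_le ((2 : ℝ) ^ d * x)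
  have h2 := Int.lt_floor_add_one ((2 : ℝ) ^ d * x)
  rw [← hb] at h1 h2
  have hp : (0 : ℝ) < 2 ^ d := by positivity
  have he : (gridPoint d b k : ℝ) = (2 * b k + 1) / 2 ^ (d + 1) := by
    simp [gridPoint]
  rw [he, one_div, inv_pow, ← one_div, abs_le, pow_succ]
  constructor
  · rw [← sub_nonneg]
    have : (2 * (b k : ℝ) + 1) / (2 ^ d * 2) - x - -(1 / (2 ^ d * 2)) =
      (b k + 1 - 2 ^ d * x) / 2 ^ d := by field_simp; ring
    rw [this]; exact div_nonneg (by linarith) hp.le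
  · rw [← sub_nonneg]
    have : 1 / (2 ^ d * 2) - ((2 * (b k : ℝ) + 1) / (2 ^ d * 2) - x) =
      (2 ^ d * x - b k) / 2 ^ d := by field_simp; ring
    rw [this]; exact div_nonneg (by linarith) hp.le

/-- The `n` extra bits absorb the sum over the coordinates, as `n < 2 ^ n`. -/
theorem gridPoint_floor_mem_ratBall (r : ℕ) (x : EuclideanSpace ℝ (Fin n)) :
    gridPoint (r + n) (fun k => ⌊(2 : ℝ) ^ (r + n) * x k⌋) ∈ ratBall r x := by
  apply mem_ratBall_of_sum_lt
  calc ∑ k, |(gridPoint (r + n) (fun k => ⌊(2 : ℝ) ^ (r + n) * x k⌋) k : ℝ) - x k|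
      ≤ ∑ k : Fin n, ((1 / 2 : ℝ)) ^ (r + n + 1) :=
        Finset.sum_le_sum fun k _ => abs_gridPoint_sub_le _ _ _ k rfl
    _ = n * (1 / 2) ^ (n + 1) * (1 / 2) ^ r := by
        rw [Finset.sum_const, Finset.card_univ, Fintype.card_fin, nsmul_eq_mul]; ring
    _ < 1 * (1 / 2) ^ r := by
        refine mul_lt_mul_of_pos_right ?_ (by positivity)
        have : (n : ℝ) < 2 ^ n := by exact_mod_cast Nat.lt_two_pow_self
        rw [one_div, inv_pow, ← div_eq_mul_inv, div_lt_one (by positivity), pow_succ]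
        have : (0 : ℝ) < 2 ^ n := by positivity
        linarith
    _ = 2 ^ (-(r : ℤ)) := by rw [one_mul, zpow_neg, zpow_natCast, one_div, inv_pow]

end Vectors

/-! ### Recovering a unit vector from an orthogonal direction and all but two coordinates -/

section Stability

variable {n : ℕ}

/-- By Lagrange's identity the squares of the `n ^ 2` determinants add up to `2 * D ^ 2`, so they
cannot all be at most `D ^ 2 / n ^ 2`. -/
theorem exists_pair_le_abs_det {e u : Fin n → ℝ} (he : ∑ k, e k ^ 2 = 1) {D : ℝ} (hD : 0 < D)
    (hu : ∑ k, u k ^ 2 = D ^ 2) (heu : ∑ k, e k * u k = 0) :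
    ∃ i j : Fin n, i ≠ j ∧ D ≤ n * |e i * u j - e j * u i| := by
  by_contra! hcon
  have hsum : ∑ i, ∑ j, (e i * u j - e j * u i) ^ 2 = 2 * D ^ 2 := by
    have h1 : ∀ i j, (e i * u j - e j * u i) ^ 2 =
        e i ^ 2 * u j ^ 2 - 2 * (e i * u i) * (e j * u j) + u i ^ 2 * e j ^ 2 := by
      intro i j; ring
    simp only [h1, Finset.sum_add_distrib, Finset.sum_sub_distrib, ← Finset.mul_sum,
      ← Finset.sum_mul, heu, hu, he]
    ring
  have hn : 0 < (n : ℝ) := by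
    rcases Nat.eq_zero_or_pos n with rfl | h
    · simp at he
    · exact_mod_cast h
  have hle : ∀ i j, (n : ℝ) ^ 2 * (e i * u j - e j * u i) ^ 2 ≤ D ^ 2 := by
    intro i j
    rw [← mul_pow, sq_le_sq, abs_mul, abs_of_pos hn, abs_of_pos hD]
    rcases eq_or_ne i j with rfl | hij
    · rw [mul_comm (e i), sub_self, abs_zero, mul_zero]; exact hD.le
    · exact (hcon i j hij).le
  have h2 : (n : ℝ) ^ 2 * ∑ i, ∑ j, (e i * u j - e j * u i) ^ 2 ≤ (n : ℝ) ^ 2 * D ^ 2 := by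
    simp only [Finset.mul_sum]
    refine (Finset.sum_le_sum fun i _ => Finset.sum_le_sum fun j _ => hle i j).trans_eq ?_
    simp only [Finset.sum_const, Finset.card_univ, Fintype.card_fin, nsmul_eq_mul]
    ring
  rw [hsum] at h2
  have : (0 : ℝ) < n ^ 2 * D ^ 2 := by positivity
  linarith

theorem sum_eq_add_add_sum_of_ne {i j : Fin n} (hij : i ≠ j) (f : Fin n → ℝ) :
    ∑ k, f k = f i + f j + ∑ k ∈ (Finset.univ.erase i).erase j, f k := by
  rw [← Finset.add_sum_erase _ _ (Finset.mem_univ i), add_assoc,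
    Finset.add_sum_erase _ _ (Finset.mem_erase.2 ⟨hij.symm, Finset.mem_univ j⟩)]

theorem abs_sum_erase_le (i j : Fin n) {f : Fin n → ℝ} {c : ℝ} (hc : 0 ≤ c)
    (hf : ∀ k, k ≠ i → k ≠ j → |f k| ≤ c) :
    |∑ k ∈ (Finset.univ.erase i).erase j, f k| ≤ n * c := by
  refine (Finset.abs_sum_le_sum_abs _ _).trans ?_
  refine (Finset.sum_le_card_nsmul _ _ c fun k hk => ?_).trans ?_
  · simp only [Finset.mem_erase] at hk
    exact hf k hk.2.1 hk.1
  · rw [nsmul_eq_mul]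
    refine mul_le_mul_of_nonneg_right ?_ hc
    exact_mod_cast (Finset.card_le_card (by intro k _; simp)).trans_eq (Finset.card_fin n)

theorem abs_le_one_of_sum_sq {e : Fin n → ℝ} (he : ∑ k, e k ^ 2 = 1) (k : Fin n) : |e k| ≤ 1 := by
  rw [← sq_le_one_iff_abs_le_one, ← he]
  exact Finset.single_le_sum (f := fun k => e k ^ 2) (fun k _ => sq_nonneg _) (Finset.mem_univ k)

/-- Quantitative uniqueness, with `v` a unit vector orthogonal to `e` and `Δ` the error. -/
theorem sum_abs_le_of_near_solution {e v Δ : Fin n → ℝ} {i j : Fin n} (hij : i ≠ j)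
    (he : ∑ k, e k ^ 2 = 1) (hv : ∑ k, v k ^ 2 = 1) {δ : ℝ} (hδ0 : 0 ≤ δ) (hδ1 : δ ≤ 1)
    (hdet : 1 ≤ n * |e i * v j - e j * v i|)
    (hA : |∑ k, Δ k * v k| ≤ (3 * n + 1) * δ)
    (hB : |∑ k, (2 * (e k * Δ k) + Δ k ^ 2)| ≤ 3 * n * δ)
    (hC : ∀ k, k ≠ i → k ≠ j → |Δ k| ≤ δ)
    (hi : |Δ i| * (2 * n) ≤ 1) (hj : |Δ j| * (2 * n) ≤ 1) :
    ∑ k, |Δ k| ≤ 60 * n ^ 2 * δ := by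
  have hn : 1 ≤ (n : ℝ) := by exact_mod_cast i.pos
  have he1 := abs_le_one_of_sum_sq he
  have hv1 := abs_le_one_of_sum_sq hv
  set X := Δ i with hX
  set Y := Δ j with hY
  have hα : |X * v i + Y * v j| ≤ (4 * n + 1) * δ := by
    have h1 := abs_sum_erase_le i j hδ0 (f := fun k => Δ k * v k) (fun k h1 h2 => by
      rw [abs_mul]
      exact (mul_le_mul (hC k h1 h2) (hv1 k) (abs_nonneg _) hδ0).trans_eq (mul_one _))
    have h2 := sum_eq_add_add_sum_of_ne hij fun k => Δ k * v k
    rw [h2] at hA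
    have h3 := abs_sub (Δ i * v i + Δ j * v j + ∑ k ∈ (Finset.univ.erase i).erase j, Δ k * v k)
      (∑ k ∈ (Finset.univ.erase i).erase j, Δ k * v k)
    rw [add_sub_cancel_right] at h3
    linarith
  have hβ : |2 * (e i * X + e j * Y) + (X ^ 2 + Y ^ 2)| ≤ 6 * n * δ := by
    have h1 := abs_sum_erase_le i j (c := 3 * δ) (by linarith)
      (f := fun k => 2 * (e k * Δ k) + Δ k ^ 2) (fun k h1 h2 => by
        have h3 := hC k h1 h2
        have h4 : |e k * Δ k| ≤ δ := by
          rw [abs_mul]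
          exact (mul_le_mul (he1 k) h3 (abs_nonneg _) zero_le_one).trans_eq (one_mul _)
        have h5 : |Δ k ^ 2| ≤ δ := by
          rw [abs_pow, sq]
          exact (mul_le_mul h3 (h3.trans hδ1) (abs_nonneg _) hδ0).trans_eq (mul_one _)
        refine (abs_add_le _ _).trans ?_
        rw [abs_mul, abs_two]
        linarith)
    have h2 := sum_eq_add_add_sum_of_ne hij fun k => 2 * (e k * Δ k) + Δ k ^ 2
    rw [h2] at hB
    set T := ∑ k ∈ (Finset.univ.erase i).erase j, (2 * (e k * Δ k) + Δ k ^ 2)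
    have h3 := abs_sub (2 * (e i * Δ i) + Δ i ^ 2 + (2 * (e j * Δ j) + Δ j ^ 2) + T) T
    rw [add_sub_cancel_right] at h3
    have h4 : 2 * (e i * X + e j * Y) + (X ^ 2 + Y ^ 2) =
      2 * (e i * Δ i) + Δ i ^ 2 + (2 * (e j * Δ j) + Δ j ^ 2) := by ring
    rw [h4]
    linarith
  set det := e i * v j - e j * v i with hdetdef
  set α := X * v i + Y * v j with hαdef
  set β := 2 * (e i * X + e j * Y) + (X ^ 2 + Y ^ 2) with hβdef
  -- Cramer's rule for the errors `X`, `Y` in the two unknown coordinates, with the quadratic part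
  -- of the norm equation treated as a perturbation.
  have key : ∀ x y s : ℝ, |x| ≤ 1 → |y| ≤ 1 → det * s = x * (β - (X ^ 2 + Y ^ 2)) / 2 - y * α →
      |det| * |s| ≤ (3 * n * δ + (X ^ 2 + Y ^ 2) / 2) + (4 * n + 1) * δ := by
    intro x y s hx hy hs
    rw [← abs_mul, hs]
    refine (abs_sub _ _).trans (add_le_add ?_ ?_)
    · rw [abs_div, abs_mul, abs_two]
      have h1 : |β - (X ^ 2 + Y ^ 2)| ≤ 6 * n * δ + (X ^ 2 + Y ^ 2) := by
        refine (abs_sub _ _).trans (add_le_add hβ (le_of_eq (abs_of_nonneg (by positivity))))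
      have h2 := mul_le_mul hx h1 (abs_nonneg _) zero_le_one
      linarith
    · rw [abs_mul]
      exact (mul_le_mul hy hα (abs_nonneg _) zero_le_one).trans_eq (one_mul _)
  have hXd := key (v j) (e j) X (hv1 j) (he1 j) (by rw [hdetdef, hαdef, hβdef]; ring)
  have hYd := key (-v i) (-e i) Y (by rw [abs_neg]; exact hv1 i) (by rw [abs_neg]; exact he1 i)
    (by rw [hdetdef, hαdef, hβdef]; ring)
  -- Being close to `e` rules out the other root: the quadratic terms contribute at most half of
  -- `|X| + |Y|` and are absorbed on the left in `hXY`.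
  have hX2 : X ^ 2 * (2 * n) ≤ |X| := by
    rw [← sq_abs, sq, mul_assoc]
    exact (mul_le_mul_of_nonneg_left hi (abs_nonneg _)).trans_eq (mul_one _)
  have hY2 : Y ^ 2 * (2 * n) ≤ |Y| := by
    rw [← sq_abs, sq, mul_assoc]
    exact (mul_le_mul_of_nonneg_left hj (abs_nonneg _)).trans_eq (mul_one _)
  have hXY : |X| + |Y| ≤ 4 * n * ((7 * n + 1) * δ) := by
    have h1 : |X| ≤ n * (|det| * |X|) := by
      rw [← mul_assoc]
      exact le_mul_of_one_le_left (abs_nonneg _) hdet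
    have h2 : |Y| ≤ n * (|det| * |Y|) := by
      rw [← mul_assoc]
      exact le_mul_of_one_le_left (abs_nonneg _) hdet
    have h3 := mul_le_mul_of_nonneg_left hXd (by positivity : (0 : ℝ) ≤ n)
    have h4 := mul_le_mul_of_nonneg_left hYd (by positivity : (0 : ℝ) ≤ n)
    nlinarith
  have hrest := abs_sum_erase_le i j hδ0 (f := fun k => |Δ k|) (fun k h1 h2 => by
    rw [abs_abs]; exact hC k h1 h2)
  have hsum := sum_eq_add_add_sum_of_ne hij fun k => |Δ k|
  have h5 := le_abs_self (∑ k ∈ (Finset.univ.erase i).erase j, |Δ k|)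
  have h6 : (n : ℝ) * δ ≤ n ^ 2 * δ := by
    refine mul_le_mul_of_nonneg_right ?_ hδ0
    nlinarith
  rw [hsum]
  nlinarith

end Stability

/-! ### The search for a unit vector on a grid -/

section Search

variable {n : ℕ}

/-- `b` is an acceptable approximation, on the grid of mesh `2 ^ (-m)`, of a unit vector that is
close to `E` (in units of `2 ^ (-(n + 3))`), nearly orthogonal to `u`, and has the coordinates `g`
other than the `i`-th and the `j`-th. -/
def IsCandidate (i j : Fin n) (E g u : Fin n → ℤ) (m : ℕ) (b : Fin n → ℤ) : Prop :=
  |∑ k, (2 * b k + 1) * u k| ≤ (n + 1) * 2 ^ (m + 1) ∧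
  |∑ k, (2 * b k + 1) * (2 * b k + 1) - 2 ^ (m + 1) * 2 ^ (m + 1)| ≤ 3 * n * 2 ^ (m + 1) ∧
  (∀ k, k ≠ i → k ≠ j → b k = g k) ∧
  ∀ k, k = i ∨ k = j →
    |2 ^ (n + 3) * (2 * b k + 1) - 2 ^ (m + 1) * E k| ≤ 2 * 2 ^ (m + 1)

variable {e v : Fin n → ℝ} {N : ℝ} {u E g : Fin n → ℤ} {m : ℕ}

theorem abs_odd_floor_sub_le (x : ℝ) (m : ℕ) :
    |(2 * (⌊(2 : ℝ) ^ m * x⌋ : ℝ) + 1) - 2 ^ (m + 1) * x| ≤ 1 := by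
  have h1 := Int.floor_le ((2 : ℝ) ^ m * x)
  have h2 := Int.lt_floor_add_one ((2 : ℝ) ^ m * x)
  rw [abs_le, pow_succ]
  constructor <;> linarith

theorem abs_floor_sub_le (x : ℝ) : |(⌊x⌋ : ℝ) - x| ≤ 1 := by
  have h1 := Int.floor_le x
  have h2 := Int.lt_floor_add_one x
  rw [abs_le]
  constructor <;> linarith

theorem sum_le_card_mul {f : Fin n → ℝ} {c : ℝ} (hf : ∀ k, f k ≤ c) : ∑ k, f k ≤ n * c := by
  refine (Finset.sum_le_card_nsmul _ _ c fun k _ => hf k).trans_eq ?_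
  rw [Finset.card_univ, Fintype.card_fin, nsmul_eq_mul]

/-- This guarantees that the search halts. The odd numerators `P k` differ from `Q * e k`, `Q = 2 ^
(m + 1)`, by at most `1`. Since `m` exceeds `∑ |u k|`, this rounding costs at most `Q` in the
product with `u`, and the error of `u` costs at most `n * Q`. In the norm each coordinate costs at
most `2 * Q + 1 ≤ 3 * Q`. -/
theorem isCandidate_floor (i j : Fin n) (he : ∑ k, e k ^ 2 = 1) (hev : ∑ k, e k * v k = 0)
    (hu : ∀ k, |(u k : ℝ) - N * v k| ≤ 1) (hE : ∀ k, E k = ⌊(2 : ℝ) ^ (n + 3) * e k⌋)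
    (hg : ∀ k, k ≠ i → k ≠ j → g k = ⌊(2 : ℝ) ^ m * e k⌋)
    (hm : m = ∑ k, (u k).natAbs + (n + 3)) :
    IsCandidate i j E g u m fun k => ⌊(2 : ℝ) ^ m * e k⌋ := by
  have he1 := abs_le_one_of_sum_sq he
  have hP : ∀ k, |(2 * (⌊(2 : ℝ) ^ m * e k⌋ : ℝ) + 1) - 2 ^ (m + 1) * e k| ≤ 1 :=
    fun k => abs_odd_floor_sub_le (e k) m
  have hQ1 : (1 : ℝ) ≤ 2 ^ (m + 1) := one_le_pow₀ (by norm_num)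
  have hmQ : (m : ℝ) ≤ 2 ^ (m + 1) := by
    have : m ≤ 2 ^ (m + 1) := (Nat.lt_two_pow_self.le).trans (Nat.pow_le_pow_right (by norm_num)
      (Nat.le_succ m))
    exact_mod_cast this
  have hsumu : ∑ k, |(u k : ℝ)| ≤ m := by
    rw [hm]
    push_cast
    simp only [Nat.cast_natAbs, Int.cast_abs]
    have : (0 : ℝ) ≤ n := by positivity
    linarith
  refine ⟨?_, ?_, fun k hki hkj => (hg k hki hkj).symm, ?_⟩
  · have h : |∑ k, (2 * (⌊(2 : ℝ) ^ m * e k⌋ : ℝ) + 1) * u k| ≤ (n + 1) * 2 ^ (m + 1) := by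
      set P : Fin n → ℝ := fun k => 2 * (⌊(2 : ℝ) ^ m * e k⌋ : ℝ) + 1
      set Q : ℝ := 2 ^ (m + 1)
      have h1 : ∑ k, P k * u k = ∑ k, (P k - Q * e k) * u k + Q * ∑ k, e k * (u k - N * v k) := by
        have : Q * ∑ k, e k * (u k - N * v k) =
            ∑ k, Q * e k * u k - Q * N * ∑ k, e k * v k := by
          simp only [Finset.mul_sum, ← Finset.sum_sub_distrib]
          exact Finset.sum_congr rfl fun k _ => by ring
        rw [this, hev, mul_zero, sub_zero, ← Finset.sum_add_distrib]
        exact Finset.sum_congr rfl fun k _ => by ring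
      have h2 : |∑ k, (P k - Q * e k) * u k| ≤ m := by
        refine ((Finset.abs_sum_le_sum_abs _ _).trans (Finset.sum_le_sum fun k _ => ?_)).trans hsumu
        rw [abs_mul]
        exact mul_le_of_le_one_left (abs_nonneg _) (hP k)
      have h3 : |∑ k, e k * (u k - N * v k)| ≤ n * 1 := by
        refine (Finset.abs_sum_le_sum_abs _ _).trans (sum_le_card_mul fun k => ?_)
        rw [abs_mul]
        exact mul_le_one₀ (he1 k) (abs_nonneg _) (hu k)
      rw [h1]
      refine (abs_add_le _ _).trans ?_
      rw [abs_mul, abs_of_nonneg (by positivity : (0 : ℝ) ≤ Q)]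
      have := mul_le_mul_of_nonneg_left h3 (by positivity : (0 : ℝ) ≤ Q)
      linarith
    exact_mod_cast h
  · have h : |∑ k, (2 * (⌊(2 : ℝ) ^ m * e k⌋ : ℝ) + 1) * (2 * (⌊(2 : ℝ) ^ m * e k⌋ : ℝ) + 1) -
        2 ^ (m + 1) * 2 ^ (m + 1)| ≤ 3 * n * 2 ^ (m + 1) := by
      set P : Fin n → ℝ := fun k => 2 * (⌊(2 : ℝ) ^ m * e k⌋ : ℝ) + 1
      set Q : ℝ := 2 ^ (m + 1)
      have h1 : ∑ k, P k * P k - Q * Q = ∑ k, (P k - Q * e k) * (P k + Q * e k) := by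
        have : Q * Q = ∑ k, Q * Q * e k ^ 2 := by rw [← Finset.mul_sum, he, mul_one]
        rw [this, ← Finset.sum_sub_distrib]
        exact Finset.sum_congr rfl fun k _ => by ring
      rw [show (∑ k, (2 * (⌊(2 : ℝ) ^ m * e k⌋ : ℝ) + 1) * (2 * (⌊(2 : ℝ) ^ m * e k⌋ : ℝ) + 1)) =
        ∑ k, P k * P k from rfl, h1]
      refine (Finset.abs_sum_le_sum_abs _ _).trans
        ((sum_le_card_mul (c := 3 * Q) fun k => ?_).trans_eq (by ring))
      rw [abs_mul]
      refine (mul_le_of_le_one_left (abs_nonneg _) (hP k)).trans ?_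
      have h2 : P k + Q * e k = (P k - Q * e k) + 2 * (Q * e k) := by ring
      have h3 : |Q * e k| ≤ Q := by
        rw [abs_mul, abs_of_nonneg (by positivity : (0 : ℝ) ≤ Q)]
        exact mul_le_of_le_one_right (by positivity) (he1 k)
      rw [h2]
      refine (abs_add_le _ _).trans ?_
      rw [abs_mul, abs_two]
      have := hP k
      linarith
    exact_mod_cast h
  · intro k _
    have h : |2 ^ (n + 3) * (2 * (⌊(2 : ℝ) ^ m * e k⌋ : ℝ) + 1) - 2 ^ (m + 1) * E k| ≤
        2 * 2 ^ (m + 1) := by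
      rw [hE]
      have h1 := abs_floor_sub_le ((2 : ℝ) ^ (n + 3) * e k)
      have h2 : (2 : ℝ) ^ (n + 3) * (2 * (⌊(2 : ℝ) ^ m * e k⌋ : ℝ) + 1) -
          2 ^ (m + 1) * ⌊(2 : ℝ) ^ (n + 3) * e k⌋ =
          2 ^ (n + 3) * ((2 * (⌊(2 : ℝ) ^ m * e k⌋ : ℝ) + 1) - 2 ^ (m + 1) * e k) -
          2 ^ (m + 1) * (⌊(2 : ℝ) ^ (n + 3) * e k⌋ - (2 : ℝ) ^ (n + 3) * e k) := by ring
      rw [h2]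
      refine (abs_sub _ _).trans ?_
      rw [abs_mul, abs_mul, abs_of_pos (by positivity : (0 : ℝ) < 2 ^ (n + 3)),
        abs_of_pos (by positivity : (0 : ℝ) < 2 ^ (m + 1))]
      have h3 := mul_le_of_le_one_right (by positivity : (0 : ℝ) ≤ 2 ^ (n + 3)) (hP k)
      have h4 := mul_le_of_le_one_right (by positivity : (0 : ℝ) ≤ 2 ^ (m + 1)) h1
      have h5 : (2 : ℝ) ^ (n + 3) ≤ 2 ^ (m + 1) := pow_le_pow_right₀ (by norm_num) (by omega)
      linarith
    exact_mod_cast h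

theorem IsCandidate.sum_abs_sub_le {i j : Fin n} (hij : i ≠ j) {b : Fin n → ℤ}
    (hb : IsCandidate i j E g u m b) (he : ∑ k, e k ^ 2 = 1) (hev : ∑ k, e k * v k = 0)
    {D : ℝ} (hD : 0 < D) (hv : ∑ k, v k ^ 2 = D ^ 2) (hN : 0 < N) (hND : 2 * n ≤ N * D)
    (hdet : D ≤ n * |e i * v j - e j * v i|)
    (hu : ∀ k, |(u k : ℝ) - N * v k| ≤ 1) (hE : ∀ k, E k = ⌊(2 : ℝ) ^ (n + 3) * e k⌋)
    (hg : ∀ k, k ≠ i → k ≠ j → g k = ⌊(2 : ℝ) ^ m * e k⌋)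
    (hm : m = ∑ k, (u k).natAbs + (n + 3)) :
    ∑ k, |(gridPoint m b k : ℝ) - e k| ≤ 60 * n ^ 2 / (N * D) := by
  obtain ⟨h1, h2, h3, h4⟩ := hb
  have hn : 1 ≤ (n : ℝ) := by exact_mod_cast i.pos
  have hn2 : (n : ℝ) ≤ 2 ^ n := by exact_mod_cast Nat.lt_two_pow_self.le
  set P : Fin n → ℝ := fun k => 2 * (b k : ℝ) + 1 with hP
  set Q : ℝ := 2 ^ (m + 1) with hQdef
  have hQ : 0 < Q := by positivity
  have h1' : |∑ k, P k * u k| ≤ (n + 1) * Q := by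
    simp only [hP, hQdef]
    exact_mod_cast h1
  have h2' : |∑ k, P k * P k - Q * Q| ≤ 3 * n * Q := by
    simp only [hP, hQdef]
    exact_mod_cast h2
  have h4' : ∀ k, k = i ∨ k = j → |2 ^ (n + 3) * P k - Q * E k| ≤ 2 * Q := by
    intro k hk
    simp only [hP, hQdef]
    exact_mod_cast h4 k hk
  have hp : ∀ k, (gridPoint m b k : ℝ) = P k / Q := by
    intro k
    simp [gridPoint, hP, hQdef]
  simp only [hp]
  have hND0 : 0 < N * D := by positivity
  have hQn : 3 * n ≤ Q := by
    have h5 : (2 : ℝ) ^ (n + 3) ≤ Q := pow_le_pow_right₀ (by norm_num) (by omega)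
    rw [pow_add] at h5
    linarith
  -- The length `D` is not available to the machine; a precision `m` above `∑ |u k|` still makes the
  -- mesh finer than `1 / (N * D)`.
  have hQND : N * D ≤ Q := by
    have h5 : D ≤ ∑ k, |v k| := by
      rw [← abs_of_pos hD, ← Real.sqrt_sq_eq_abs, ← hv,
        Real.sqrt_le_left (Finset.sum_nonneg fun k _ => abs_nonneg _)]
      simp only [← sq_abs (v _)]
      exact Finset.sum_sq_le_sq_sum_of_nonneg fun k _ => abs_nonneg _
    have h6 : ∑ k, N * |v k| ≤ ∑ k, (|(u k : ℝ)| + 1) := by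
      refine Finset.sum_le_sum fun k _ => ?_
      have h7 := abs_sub_abs_le_abs_sub (N * v k) (u k)
      rw [abs_mul, abs_of_pos hN, abs_sub_comm] at h7
      have := hu k
      linarith
    rw [← Finset.mul_sum, Finset.sum_add_distrib, Finset.sum_const, Finset.card_univ,
      Fintype.card_fin, nsmul_eq_mul, mul_one] at h6
    have h7 : ∑ k, |(u k : ℝ)| ≤ m := by
      rw [hm]
      push_cast
      simp only [Nat.cast_natAbs, Int.cast_abs]
      linarith
    have h8 : (m : ℝ) ≤ 2 ^ m := by exact_mod_cast Nat.lt_two_pow_self.le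
    have h9 := mul_le_mul_of_nonneg_left h5 hN.le
    rw [hQdef, pow_succ]
    linarith
  have hδ : 1 / Q ≤ 1 / (N * D) := one_div_le_one_div_of_le hND0 hQND
  have hδ1 : 1 / (N * D) ≤ 1 := by
    rw [div_le_one hND0]
    linarith
  have hPQ : ∀ k, |P k| ≤ 2 * Q := by
    intro k
    have h5 : P k * P k ≤ ∑ k, P k * P k :=
      Finset.single_le_sum (f := fun k => P k * P k) (fun k _ => mul_self_nonneg _)
        (Finset.mem_univ k)
    have h6 := (abs_le.1 h2').2
    refine abs_le_of_sq_le_sq ?_ (by positivity)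
    nlinarith
  have hEe : ∀ k, |(E k : ℝ) - 2 ^ (n + 3) * e k| ≤ 1 := by
    intro k
    rw [hE]
    exact abs_floor_sub_le _
  -- The error is at most `3 / 2 ^ (n + 3)`, which is below `1 / (2 * n)`; this is what the `n + 3`
  -- bits in `E` are for.
  have hclose : ∀ k, k = i ∨ k = j → |P k / Q - e k| * (2 * n) ≤ 1 := by
    intro k hk
    have h5 : 2 ^ (n + 3) * (P k / Q - e k) =
        (2 ^ (n + 3) * P k - Q * E k) / Q + (E k - 2 ^ (n + 3) * e k) := by
      field_simp
      ring
    have h6 : 2 ^ (n + 3) * |P k / Q - e k| ≤ 2 + 1 := by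
      rw [← abs_of_pos (by positivity : (0 : ℝ) < 2 ^ (n + 3)), ← abs_mul, h5]
      refine (abs_add_le _ _).trans (add_le_add ?_ (hEe k))
      rw [abs_div, abs_of_pos hQ, div_le_iff₀ hQ]
      exact h4' k hk
    rw [pow_add] at h6
    nlinarith [abs_nonneg (P k / Q - e k)]
  -- After normalising to `v / D` every error is measured in the unit `1 / (N * D)`. In the linear
  -- equation `n + 1` comes from the tolerance and `2 * n` from replacing `u` by `N * v`.
  have hmain := sum_abs_le_of_near_solution (e := e) (v := fun k => v k / D)
    (Δ := fun k => P k / Q - e k) (δ := 1 / (N * D)) hij he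
    (by simp only [div_pow, ← Finset.sum_div, hv]; exact div_self (by positivity))
    (by positivity) hδ1 ?_ ?_ ?_ ?_ (hclose i (Or.inl rfl)) (hclose j (Or.inr rfl))
  · refine hmain.trans_eq ?_
    ring
  · have h5 : e i * (v j / D) - e j * (v i / D) = (e i * v j - e j * v i) / D := by ring
    rw [h5, abs_div, abs_of_pos hD, mul_div_assoc', le_div_iff₀ hD, one_mul]
    exact hdet
  · have h5 : ∑ k, (P k / Q - e k) * (v k / D) =
        (∑ k, P k * u k - ∑ k, P k * (u k - N * v k)) / (Q * (N * D)) := by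
      have h6 : ∑ k, (P k / Q - e k) * (v k / D) = ∑ k, P k / Q * (v k / D) := by
        have : ∑ k, e k * (v k / D) = 0 := by
          simp only [mul_div_assoc', ← Finset.sum_div, hev, zero_div]
        rw [← sub_zero (∑ k, P k / Q * (v k / D)), ← this, ← Finset.sum_sub_distrib]
        exact Finset.sum_congr rfl fun k _ => by ring
      rw [h6, ← Finset.sum_sub_distrib, Finset.sum_div]
      refine Finset.sum_congr rfl fun k _ => ?_
      field_simp
      ring
    have h7 : |∑ k, P k * (u k - N * v k)| ≤ n * (2 * Q) := by
      refine (Finset.abs_sum_le_sum_abs _ _).trans (sum_le_card_mul fun k => ?_)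
      rw [abs_mul]
      exact (mul_le_mul (hPQ k) (hu k) (abs_nonneg _) (by positivity)).trans_eq (mul_one _)
    rw [h5, abs_div, abs_of_pos (by positivity : 0 < Q * (N * D)), div_le_iff₀ (by positivity)]
    have h8 : (3 * (n : ℝ) + 1) * (1 / (N * D)) * (Q * (N * D)) = (3 * n + 1) * Q := by
      field_simp
    rw [h8]
    refine (abs_sub _ _).trans ?_
    linarith
  · have h5 : ∑ k, (2 * (e k * (P k / Q - e k)) + (P k / Q - e k) ^ 2) =
        (∑ k, P k * P k - Q * Q) / (Q * Q) := by
      have h6 : (∑ k, P k * P k - Q * Q) / (Q * Q) = ∑ k, P k * P k / (Q * Q) - ∑ k, e k ^ 2 := by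
        rw [he, ← Finset.sum_div, sub_div, div_self (by positivity)]
      rw [h6, ← Finset.sum_sub_distrib]
      refine Finset.sum_congr rfl fun k _ => ?_
      field_simp
      ring
    rw [h5, abs_div, abs_of_pos (by positivity : 0 < Q * Q), div_le_iff₀ (by positivity)]
    refine h2'.trans ?_
    have h7 : 3 * (n : ℝ) * Q = 3 * n * (1 / Q) * (Q * Q) := by field_simp
    rw [h7]
    gcongr
  · intro k hki hkj
    have h5 := abs_odd_floor_sub_le (e k) m
    rw [← hg k hki hkj, ← h3 k hki hkj] at h5
    have h6 : P k / Q - e k = (P k - Q * e k) / Q := by field_simp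
    refine le_trans ?_ hδ
    rw [h6, abs_div, abs_of_pos hQ]
    exact div_le_div_of_nonneg_right h5 hQ.le

end Search

/-! ### Reading real numbers from an oracle -/

theorem floor_two_mul (x : ℝ) : ⌊2 * x⌋ = 2 * ⌊x⌋ + ⌊2 * x⌋ % 2 := by
  have h1 := Int.floor_le x
  have h2 := Int.lt_floor_add_one x
  have h3 : 2 * ⌊x⌋ ≤ ⌊2 * x⌋ := Int.le_floor.2 (by push_cast; linarith)
  have h4 : ⌊2 * x⌋ < 2 * ⌊x⌋ + 2 := Int.floor_lt.2 (by push_cast; linarith)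
  omega

theorem OracleCode.answer_realOracle {ι : Type*} [Encodable ι] (y : ι → ℝ) (k : ι) (m : ℕ) :
    (answer (realOracle y) (Nat.pair (encode k) (Nat.pair (m + 1) 0)) : ℤ) =
      ⌊(2 : ℝ) ^ (m + 1) * y k⌋ % 2 := by
  have h : Nat.pair (encode k) (Nat.pair (m + 1) 0) ∈ realOracle y ↔
      ⌊(2 : ℝ) ^ (m + 1) * y k⌋ % 2 = 1 := by
    constructor
    · rintro (⟨k', hk'⟩ | ⟨k', m', -, hd, hk'⟩)
      · simp [Nat.pair_eq_pair] at hk'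
      · simp only [Nat.pair_eq_pair, Encodable.encode_inj] at hk'
        obtain ⟨rfl, rfl, -⟩ := hk'
        exact hd
    · exact fun hd => Or.inr ⟨k, m + 1, by omega, hd, rfl⟩
  unfold answer
  split_ifs with hmem
  · rw [h.1 hmem]; rfl
  · have := mt h.2 hmem
    push_cast
    omega

/-- The shift by `2` keeps the values natural; it reappears as `2 * 2 ^ m` and is subtracted by the
search. The integer part is a constant of the machine, so only fractional digits are queried. -/
theorem OracleCode.digitValue_realOracle {ι : Type*} [Encodable ι] (y : ι → ℝ) (k : ι)
    (hy : -2 ≤ y k) (m : ℕ) :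
    (digitValue (realOracle y) (encode k) (⌊y k⌋ + 2).toNat m : ℤ) =
      ⌊(2 : ℝ) ^ m * y k⌋ + 2 * 2 ^ m := by
  induction m with
  | zero =>
    have : -2 ≤ ⌊y k⌋ := Int.le_floor.2 (by push_cast; exact hy)
    simp only [digitValue, pow_zero, one_mul]
    omega
  | succ m ih =>
    rw [digitValue]
    push_cast
    rw [ih, answer_realOracle]
    have h := floor_two_mul ((2 : ℝ) ^ m * y k)
    rw [← mul_assoc, ← pow_succ'] at h
    rw [h, pow_succ]
    omega

/-! ### The search as an oracle machine -/

section SearchCode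

variable {n : ℕ}

theorem primrec_isCandidate (i j : Fin n) (E : Fin n → ℤ) :
    PrimrecPred fun q : (((Fin n → ℤ) × (Fin n → ℤ)) × ℕ) × (Fin n → ℤ) =>
      IsCandidate i j E q.1.1.1 q.1.1.2 q.1.2 q.2 := by
  have hb : ∀ k, Primrec fun q : (((Fin n → ℤ) × (Fin n → ℤ)) × ℕ) × (Fin n → ℤ) => q.2 k :=
    fun k => Primrec.fin_apply Primrec.snd k
  have hP : ∀ k, Primrec fun q : (((Fin n → ℤ) × (Fin n → ℤ)) × ℕ) × (Fin n → ℤ) =>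
      2 * q.2 k + 1 := fun k =>
    Primrec.int_add.comp (Primrec.int_mul.comp (Primrec.const 2) (hb k)) (Primrec.const 1)
  have hg : ∀ k, Primrec fun q : (((Fin n → ℤ) × (Fin n → ℤ)) × ℕ) × (Fin n → ℤ) => q.1.1.1 k :=
    fun k => Primrec.fin_apply (Primrec.fst.comp (Primrec.fst.comp Primrec.fst)) k
  have hu : ∀ k, Primrec fun q : (((Fin n → ℤ) × (Fin n → ℤ)) × ℕ) × (Fin n → ℤ) => q.1.1.2 k :=
    fun k => Primrec.fin_apply (Primrec.snd.comp (Primrec.fst.comp Primrec.fst)) k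
  have hQ : Primrec fun q : (((Fin n → ℤ) × (Fin n → ℤ)) × ℕ) × (Fin n → ℤ) =>
      (2 : ℤ) ^ (q.1.2 + 1) :=
    Primrec.int_two_pow.comp (Primrec.succ.comp (Primrec.snd.comp Primrec.fst))
  refine PrimrecPred.and ?_ (PrimrecPred.and ?_ (PrimrecPred.and ?_ ?_))
  · exact Primrec.int_le.comp (Primrec.int_abs.comp
      (Primrec.int_sum _ fun k => Primrec.int_mul.comp (hP k) (hu k)))
      (Primrec.int_mul.comp (Primrec.const _) hQ)
  · exact Primrec.int_le.comp (Primrec.int_abs.comp (Primrec.int_sub.comp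
      (Primrec.int_sum _ fun k => Primrec.int_mul.comp (hP k) (hP k))
      (Primrec.int_mul.comp hQ hQ))) (Primrec.int_mul.comp (Primrec.const _) hQ)
  · refine (Primrec.forall_finset ((Finset.univ.erase i).erase j) fun k =>
      Primrec.eq.comp (hb k) (hg k)).of_eq fun q => ?_
    simp only [Finset.mem_erase, Finset.mem_univ, and_true]
    exact forall_congr' fun k => ⟨fun h h1 h2 => h ⟨h2, h1⟩, fun h h1 => h h1.2 h1.1⟩
  · refine (Primrec.forall_finset {i, j} fun k =>
      Primrec.int_le.comp (Primrec.int_abs.comp (Primrec.int_sub.comp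
        (Primrec.int_mul.comp (Primrec.const (2 ^ (n + 3))) (hP k))
        (Primrec.int_mul.comp hQ (Primrec.const (E k)))))
        (Primrec.int_mul.comp (Primrec.const 2) hQ)).of_eq fun q => ?_
    simp only [Finset.mem_insert, Finset.mem_singleton]

/-- The difference of two truncated rational vectors, with correction `v`. -/
def directionCode (c : ℕ) (v : Fin n → ℤ) (a : (ℕ × ℕ) × ℕ) : Fin n → ℤ :=
  truncCode n (a.1.1 + c) a.1.2 - truncCode n (a.1.1 + c) a.2 + v

theorem primrec_directionCode (c : ℕ) (v : Fin n → ℤ) : Primrec (directionCode c v) := by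
  have hr : Primrec fun a : (ℕ × ℕ) × ℕ => a.1.1 + c :=
    Primrec.nat_add.comp (Primrec.fst.comp Primrec.fst) (Primrec.const c)
  exact primrec_int_vec_add.comp (primrec_int_vec_sub.comp
    (primrec_truncCode.comp hr (Primrec.snd.comp Primrec.fst))
    (primrec_truncCode.comp hr Primrec.snd)) (Primrec.const v)

/-- The precision of the search in the direction orthogonal to `u`. -/
def searchPrecision (u : Fin n → ℤ) : ℕ :=
  ∑ k, (u k).natAbs + (n + 3)

theorem primrec_searchPrecision : Primrec (searchPrecision (n := n)) := by
  have h : Primrec fun u : Fin n → ℤ => (∑ k, |u k|).toNat + (n + 3) :=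
    Primrec.nat_add.comp (Primrec.int_toNat.comp (Primrec.int_sum _ fun k =>
      Primrec.int_abs.comp (Primrec.fin_apply Primrec.id k))) (Primrec.const _)
  refine h.of_eq fun u => ?_
  have : ∑ k, |u k| = ((∑ k, (u k).natAbs : ℕ) : ℤ) := by push_cast; rfl
  rw [this, Int.toNat_natCast, searchPrecision]

open Classical in
/-- The output for the vector `b` if it passes the test. -/
noncomputable def candidateOutput (i j : Fin n) (E g u : Fin n → ℤ) (m : ℕ) (b : Fin n → ℤ) :
    Option (List (ℤ × ℕ)) :=
  if IsCandidate i j E g u m b then some (ratVecData (gridPoint m b)) else none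

theorem primrec_candidateOutput (i j : Fin n) (E : Fin n → ℤ) :
    Primrec fun q : (((Fin n → ℤ) × (Fin n → ℤ)) × ℕ) × (Fin n → ℤ) =>
      candidateOutput i j E q.1.1.1 q.1.1.2 q.1.2 q.2 := by
  classical
  exact (Primrec.ite (primrec_isCandidate i j E) (Primrec.option_some.comp
    (primrec_ratVecData_gridPoint.comp (Primrec.pair (Primrec.snd.comp Primrec.fst) Primrec.snd)))
    (Primrec.const none)).of_eq fun q => by unfold candidateOutput; congr

/-- The `s`-th stage of the search, which tests the vector given by the list with code `s`. -/
noncomputable def searchStage (i j : Fin n) (E g u : Fin n → ℤ) (m s : ℕ) :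
    Option (List (ℤ × ℕ)) :=
  (decode (α := List ℤ) s).bind fun l => candidateOutput i j E g u m fun k => l.getD k 0

theorem primrec_searchStage {α : Type*} [Primcodable α] (i j : Fin n) (E : Fin n → ℤ)
    {g u : α → Fin n → ℤ} {m : α → ℕ} (hg : Primrec g) (hu : Primrec u) (hm : Primrec m) :
    Primrec₂ fun a s => searchStage i j E (g a) (u a) (m a) s := by
  have ha : Primrec fun x : (α × ℕ) × List ℤ => x.1.1 := Primrec.fst.comp Primrec.fst
  have hb : Primrec fun (x : (α × ℕ) × List ℤ) (k : Fin n) => x.2.getD k 0 :=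
    Primrec.fin_pi fun k => (Primrec.list_getD 0).comp Primrec.snd (Primrec.const _)
  have hq : Primrec fun x : (α × ℕ) × List ℤ =>
      (((g x.1.1, u x.1.1), m x.1.1), fun k : Fin n => x.2.getD k 0) :=
    Primrec.pair (Primrec.pair (Primrec.pair (hg.comp ha) (hu.comp ha)) (hm.comp ha)) hb
  have h := (primrec_candidateOutput i j E).comp hq
  exact Primrec.option_bind (Primrec.decode.comp Primrec.snd) h.to₂

/-- For a unit vector `e`, one machine finds acceptable approximations of `e` from the coordinates
other than the `i`-th and `j`-th, given as oracle, and approximations of two points. -/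
theorem exists_search_code {e : Fin n → ℝ} (he : ∀ k, -2 ≤ e k) (i j : Fin n) (E : Fin n → ℤ)
    (c : ℕ) (v : Fin n → ℤ) {A : Set ℕ}
    (hA : A = realOracle fun k : {k : Fin n // k ≠ i ∧ k ≠ j} => e k) :
    ∃ B : OracleCode, ∀ (a : (ℕ × ℕ) × ℕ) (u : Fin n → ℤ) (m : ℕ),
      directionCode c v a = u → searchPrecision u = m →
      (∀ g : Fin n → ℤ, (∀ k, k ≠ i → k ≠ j → g k = ⌊(2 : ℝ) ^ m * e k⌋) →
        ∃ b, IsCandidate i j E g u m b) →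
      ∃ g b : Fin n → ℤ, (∀ k, k ≠ i → k ≠ j → g k = ⌊(2 : ℝ) ^ m * e k⌋) ∧
        IsCandidate i j E g u m b ∧
        encode (ratVecData (gridPoint m b)) ∈ B.eval A (encode a) := by
  classical
  -- The oracle has no blocks for `i` and `j`. The value `0` makes the machine read meaningless
  -- digits there, which is harmless because `IsCandidate` ignores `g i` and `g j`.
  let key : Fin n → ℕ := fun k => if h : k ≠ i ∧ k ≠ j then encode
    (⟨k, h⟩ : {k : Fin n // k ≠ i ∧ k ≠ j}) else 0
  let ks : List (ℕ × ℕ) := List.ofFn fun k : Fin n => (key k, (⌊e k⌋ + 2).toNat)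
  let prec : (ℕ × ℕ) × ℕ → ℕ := fun a => searchPrecision (directionCode c v a)
  have hprec : Primrec prec := primrec_searchPrecision.comp (primrec_directionCode c v)
  let known : ((ℕ × ℕ) × ℕ) × List ℕ → Fin n → ℤ := fun q k =>
    (q.2.getD k 0 : ℤ) - 2 * 2 ^ prec q.1
  have hknown : Primrec known := Primrec.fin_pi fun k => Primrec.int_sub.comp
    (Primrec.int_natCast.comp ((Primrec.list_getD 0).comp Primrec.snd (Primrec.const _)))
    (Primrec.int_mul.comp (Primrec.const 2)
      (Primrec.int_two_pow.comp (hprec.comp Primrec.fst)))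
  obtain ⟨B, hB⟩ := OracleCode.exists_eval_eq_digitValues ks hprec
    (Partrec.rfindOpt (primrec_searchStage i j E hknown
      ((primrec_directionCode c v).comp Primrec.fst) (hprec.comp Primrec.fst)).to_comp)
  refine ⟨B, fun a u m hu hm hex => ?_⟩
  set L := ks.map fun p => OracleCode.digitValue A p.1 p.2 (prec a) with hL
  have hpm : prec a = m := by rw [← hm, ← hu]
  have hkn : ∀ k, k ≠ i → k ≠ j → known (a, L) k = ⌊(2 : ℝ) ^ m * e k⌋ := by
    intro k hki hkj
    have h1 : L.getD k 0 = OracleCode.digitValue A (key k) (⌊e k⌋ + 2).toNat (prec a) := by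
      rw [hL, List.getD_eq_getElem _ _ (by simp [ks])]
      simp [ks]
    have h2 : key k = encode (⟨k, hki, hkj⟩ : {k : Fin n // k ≠ i ∧ k ≠ j}) :=
      dif_pos ⟨hki, hkj⟩
    have h3 := OracleCode.digitValue_realOracle
      (fun k : {k : Fin n // k ≠ i ∧ k ≠ j} => e k) ⟨k, hki, hkj⟩ (he k) m
    simp only [known]
    rw [h1, h2, hpm, hA, h3]
    ring
  obtain ⟨b₀, hb₀⟩ := hex _ hkn
  have hdom : (Nat.rfindOpt (searchStage i j E (known (a, L)) u m)).Dom := by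
    refine Nat.rfindOpt_dom.2 ⟨encode (List.ofFn b₀), ratVecData (gridPoint m b₀), ?_⟩
    have h : (fun k : Fin n => (List.ofFn b₀).getD k 0) = b₀ := by
      funext k
      rw [List.getD_eq_getElem _ _ (by simp)]
      simp
    rw [searchStage, encodek, Option.bind_some, h, candidateOutput, if_pos hb₀]
    rfl
  obtain ⟨l, hl⟩ := Part.dom_iff_mem.1 hdom
  obtain ⟨s, hs⟩ := Nat.rfindOpt_spec hl
  simp only [searchStage, Option.mem_def, Option.bind_eq_some_iff] at hs
  obtain ⟨l', -, hb⟩ := hs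
  obtain ⟨b, hbdef⟩ : ∃ b : Fin n → ℤ, b = fun k : Fin n => l'.getD k 0 := ⟨_, rfl⟩
  rw [← hbdef, candidateOutput] at hb
  split_ifs at hb with hcand
  obtain rfl := Option.some.inj hb
  refine ⟨known (a, L), b, hkn, hcand, ?_⟩
  rw [hB]
  refine Part.mem_map _ ?_
  change ratVecData (gridPoint m b) ∈ Nat.rfindOpt fun s =>
    searchStage i j E (known (a, L)) (directionCode c v a) (prec a) s
  rw [hu, hpm]
  exact hl

end SearchCode

/-! ### Sizes of codes -/

theorem size_pair_le {a b s : ℕ} (ha : Nat.size a ≤ s) (hb : Nat.size b ≤ s) :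
    Nat.size (Nat.pair a b) ≤ 2 * s := by
  rw [Nat.size_le] at ha hb ⊢
  refine (Nat.pair_lt_max_add_one_sq a b).trans_le ?_
  rw [mul_comm, pow_mul]
  exact Nat.pow_le_pow_left (by omega) 2

theorem size_mul_le (a b : ℕ) : Nat.size (a * b) ≤ Nat.size a + Nat.size b := by
  rw [Nat.size_le, pow_add]
  exact Nat.mul_lt_mul'' (Nat.lt_size_self a) (Nat.lt_size_self b)

theorem size_le_two_mul_log {r : ℕ} (hr : 2 ≤ r) : Nat.size r ≤ 2 * Nat.log 2 r := by
  have h1 : 1 ≤ Nat.log 2 r := Nat.log_pos (by norm_num) hr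
  rw [Nat.size_le]
  refine (Nat.lt_pow_succ_log_self (by norm_num) r).trans_le
    (Nat.pow_le_pow_right (by norm_num) (by omega))

theorem size_encode_int_le {x : ℤ} {s : ℕ} (hx : |x| ≤ 2 ^ s) : Nat.size (encode x) ≤ s + 2 := by
  have h0 : 0 < 2 ^ s := by positivity
  have hx' : x.natAbs ≤ 2 ^ s := by zify; exact hx
  rw [Nat.size_le, pow_add]
  rcases Primrec.int_encode_cases x with ⟨k, hk, he⟩ | ⟨k, hk, he⟩ <;> rw [he] <;> omega

/-- Each pairing at most doubles the size, up to `1`. The exponential factor does no harm, as the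
lists have the fixed length `n`. -/
theorem size_encode_list_le {l : List ℤ} {s : ℕ} (hl : ∀ x ∈ l, Nat.size (encode x) ≤ s) :
    Nat.size (encode l) ≤ 3 ^ l.length * (s + 1) := by
  induction l with
  | nil => simp
  | cons x l ih =>
    have h1 := ih fun y hy => hl y (List.mem_cons_of_mem _ hy)
    have h2 := hl x List.mem_cons_self
    have h3 : 1 ≤ 3 ^ l.length := Nat.one_le_pow _ _ (by norm_num)
    have h4 : s + 1 ≤ 3 ^ l.length * (s + 1) := Nat.le_mul_of_pos_left _ h3
    have h5 := size_pair_le (h2.trans (by omega)) h1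
    rw [Encodable.encode_list_cons, List.length_cons, pow_succ]
    have h6 : Nat.size (Nat.succ (Nat.pair (encode x) (encode l))) ≤
        Nat.size (Nat.pair (encode x) (encode l)) + 1 := by
      rw [Nat.size_le, pow_succ]
      have := Nat.lt_size_self (Nat.pair (encode x) (encode l))
      omega
    have h7 : 3 ^ l.length * 3 * (s + 1) = 3 * (3 ^ l.length * (s + 1)) := by ring
    omega

/-- Bounded corrections range over a finite set. Each is built into a machine of its own, and the
largest of the constants serves for all, so corrections cost no program bits. -/
theorem exists_uniform_bound {ι : Type*} (s : Finset ι) {P : ι → ℕ → Prop}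
    (hmono : ∀ v c c', c ≤ c' → P v c → P v c') (h : ∀ v, ∃ c, P v c) :
    ∃ c, ∀ v ∈ s, P v c := by
  choose f hf using h
  exact ⟨s.sup f, fun v hv => hmono v _ _ (Finset.le_sup hv) (hf v)⟩

/-- The integer vectors with entries of absolute value at most `K`. -/
noncomputable def intBox (n : ℕ) (K : ℤ) : Finset (Fin n → ℤ) :=
  Fintype.piFinset fun _ => Finset.Icc (-K) K

theorem mem_intBox {n : ℕ} {K : ℤ} {v : Fin n → ℤ} : v ∈ intBox n K ↔ ∀ k, |v k| ≤ K := by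
  simp only [intBox, Fintype.mem_piFinset, Finset.mem_Icc, abs_le]

/-! ### Bounds on the complexity of points -/

theorem ratBall_mono {n : ℕ} {r s : ℤ} (h : r ≤ s) (x : EuclideanSpace ℝ (Fin n)) :
    ratBall s x ⊆ ratBall r x := by
  intro p hp
  exact Metric.ball_subset_ball (zpow_le_zpow_right₀ (by norm_num) (by omega)) hp

theorem pointComplexity_mono {n : ℕ} (U : OracleCode) (A : Set ℕ) {r s : ℤ} (h : r ≤ s)
    (x : EuclideanSpace ℝ (Fin n)) : pointComplexity U A r x ≤ pointComplexity U A s x :=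
  le_iInf₂ fun p hp => iInf₂_le p (ratBall_mono h x hp)

theorem pointComplexity_le {n : ℕ} {U : OracleCode} {A : Set ℕ} {r : ℤ}
    {x : EuclideanSpace ℝ (Fin n)} {p : Fin n → ℚ} {c : ℕ} {π : List Bool} (hp : p ∈ ratBall r x)
    (hπ : encode (ratVecData p) ∈ U.run A π 0) (hc : π.length ≤ c) :
    pointComplexity U A r x ≤ c :=
  (iInf₂_le p hp).trans (condComplexity_le_of_mem_run (τ := ([] : List Bool)) hπ hc)

theorem exists_program_of_pointComplexity_ne_top {n : ℕ} {U : OracleCode} {A : Set ℕ} {r : ℤ}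
    {x : EuclideanSpace ℝ (Fin n)} (h : pointComplexity U A r x ≠ ⊤) :
    ∃ p ∈ ratBall r x, ∃ π : List Bool, encode (ratVecData p) ∈ U.run A π 0 ∧
      (π.length : ℕ∞) ≤ pointComplexity U A r x := by
  obtain ⟨ℓ, hℓ⟩ := ENat.ne_top_iff_exists.1 h
  have hlt : pointComplexity U A r x < (ℓ + 1 : ℕ) := by
    rw [← hℓ]
    exact_mod_cast Nat.lt_succ_self ℓ
  simp only [pointComplexity, complexity, condComplexity, iInf_lt_iff] at hlt
  obtain ⟨p, hp, π, hπ, hlt⟩ := hlt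
  refine ⟨p, hp, π, hπ, ?_⟩
  rw [← hℓ]
  exact_mod_cast Nat.lt_succ_iff.1 (by exact_mod_cast hlt)

namespace OracleCode.IsUniversalPrefixFree

variable {U : OracleCode}

theorem exists_program_of_partrec (hU : U.IsUniversalPrefixFree) {η α : Type*} [Primcodable η] [Primcodable α]
    {G : (η × ℕ) × ℕ →. α} (hG : Partrec G) {len : η → ℕ} (hlen : Primrec len) :
    ∃ c : ℕ, ∀ (A : Set ℕ) (h : η) (i y : ℕ) (a : α), i < 2 ^ len h → a ∈ G ((h, i), y) →
      ∃ π : List Bool, encode a ∈ U.run A π y ∧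
        π.length ≤ 2 * Nat.size (encode h) + len h + c := by
  obtain ⟨B, hB⟩ := exists_eval_eq_of_partrec (Primrec.id (α := α)).to_comp.partrec
  obtain ⟨c, hc⟩ := hU.exists_program_of_index hG hlen B
  refine ⟨c, fun A h i y a hi ha => hc A h i y a _ hi ha ?_⟩
  rw [hB]
  exact Part.mem_map _ (Part.mem_some _)

/-- The whole grid point is passed as hint, with an empty index. The crude linear bound serves to
make the codes of program lengths logarithmic in `r`, and at precision `1` to bound `K_t(z)` for `t
≤ 0`. -/
theorem exists_pointComplexity_le_mul (hU : U.IsUniversalPrefixFree) (n s : ℕ) :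
    ∃ C : ℕ, ∀ r : ℕ, 1 ≤ r → ∀ w : EuclideanSpace ℝ (Fin n), (∀ k, |w k| ≤ 2 ^ s) →
      pointComplexity U ∅ r w ≤ (C * r : ℕ) := by
  have hG : Primrec fun q : ((ℕ × List ℤ) × ℕ) × ℕ =>
      ratVecData (gridPoint q.1.1.1 fun k : Fin n => q.1.1.2.getD k 0) := by
    have hh : Primrec fun q : ((ℕ × List ℤ) × ℕ) × ℕ => q.1.1 := Primrec.fst.comp Primrec.fst
    exact Primrec.ratVecData_gridPoint (Primrec.fst.comp hh)
      (Primrec.fin_pi fun k => (Primrec.list_getD 0).comp (Primrec.snd.comp hh) (Primrec.const _))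
  obtain ⟨c, hc⟩ := hU.exists_program_of_partrec (len := fun _ => 0) hG.to_comp.partrec
    (Primrec.const 0)
  refine ⟨4 * (3 ^ n * (n + s + 6)) + c, fun r hr w hw => ?_⟩
  let b : Fin n → ℤ := fun k => ⌊(2 : ℝ) ^ (r + n) * w k⌋
  obtain ⟨π, hπ, hlen⟩ := hc ∅ (r + n, List.ofFn b) 0 0 _ (by simp) (Part.mem_some _)
  have hget : (fun k : Fin n => (List.ofFn b).getD k 0) = b := by
    funext k
    rw [List.getD_eq_getElem _ _ (by simp)]
    simp
  simp only [hget] at hπ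
  refine pointComplexity_le (gridPoint_floor_mem_ratBall r w) hπ (hlen.trans ?_)
  have hb : ∀ x ∈ List.ofFn b, Nat.size (encode x) ≤ r + n + s + 3 := by
    intro x hx
    obtain ⟨k, rfl⟩ := List.mem_ofFn.1 hx
    refine size_encode_int_le (s := r + n + s + 1) ?_
    have h1 := abs_floor_sub_le ((2 : ℝ) ^ (r + n) * w k)
    have h2 : |(2 : ℝ) ^ (r + n) * w k| ≤ 2 ^ (r + n + s) := by
      rw [abs_mul, abs_of_pos (by positivity), pow_add _ (r + n)]
      exact mul_le_mul_of_nonneg_left (hw k) (by positivity)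
    have h3 : (1 : ℝ) ≤ 2 ^ (r + n + s) := one_le_pow₀ (by norm_num)
    have h4 : |(b k : ℝ)| ≤ 2 ^ (r + n + s + 1) := by
      have h5 := abs_sub_abs_le_abs_sub (b k : ℝ) ((2 : ℝ) ^ (r + n) * w k)
      rw [pow_succ]
      linarith
    exact_mod_cast h4
  have h1 := size_encode_list_le hb
  rw [List.length_ofFn] at h1
  have h3 : 1 ≤ 3 ^ n := Nat.one_le_pow _ _ (by norm_num)
  have h2 : Nat.size (r + n) ≤ 3 ^ n * (r + n + s + 3 + 1) := by
    have : Nat.size (r + n) ≤ r + n := Nat.size_le.2 Nat.lt_two_pow_self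
    exact this.trans ((by omega : r + n ≤ r + n + s + 3 + 1).trans (Nat.le_mul_of_pos_left _ h3))
  have h4 := size_pair_le h2 h1
  have h5 : encode (r + n, List.ofFn b) = Nat.pair (r + n) (encode (List.ofFn b)) := rfl
  rw [h5]
  have h6 : r + n + s + 3 + 1 ≤ (n + s + 6) * r := by nlinarith
  have h7 := Nat.mul_le_mul_left (3 ^ n) h6
  have h8 : c ≤ c * r := Nat.le_mul_of_pos_right _ hr
  have h9 : (4 * (3 ^ n * (n + s + 6)) + c) * r = 4 * (3 ^ n * ((n + s + 6) * r)) + c * r := by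
    ring
  rw [h9]
  omega

/-- A point close to `x / 2 ^ d` is described by `x`. -/
theorem exists_pointComplexity_le_of_feature (hU : U.IsUniversalPrefixFree) (n : ℕ)
    {E : ((ℕ × ℕ) × ℕ) × ℕ →. (Fin n → ℤ)} (hE : Partrec E) (K : ℤ) :
    ∃ c : ℕ, ∀ (d ℓ k i : ℕ) (z : EuclideanSpace ℝ (Fin n)) (x : Fin n → ℤ),
      i < 2 ^ (ℓ - k) → x ∈ E (((d, ℓ), k), i) →
      (∀ κ, |⌊(2 : ℝ) ^ (d + n) * z κ⌋ - 2 ^ n * x κ| ≤ K) →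
      pointComplexity U ∅ d z ≤ (2 * Nat.size (encode ((d, ℓ), k)) + (ℓ - k) + c : ℕ) := by
  have key : ∀ v : Fin n → ℤ, ∃ c : ℕ, ∀ (d ℓ k i : ℕ) (z : EuclideanSpace ℝ (Fin n))
      (x : Fin n → ℤ), i < 2 ^ (ℓ - k) → x ∈ E (((d, ℓ), k), i) →
      (v = fun κ => ⌊(2 : ℝ) ^ (d + n) * z κ⌋ - 2 ^ n * x κ) →
      pointComplexity U ∅ d z ≤ (2 * Nat.size (encode ((d, ℓ), k)) + (ℓ - k) + c : ℕ) := by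
    intro v
    have hout : Primrec₂ fun (q : (((ℕ × ℕ) × ℕ) × ℕ) × ℕ) (x : Fin n → ℤ) =>
        ratVecData (gridPoint (q.1.1.1.1 + n) fun κ => 2 ^ n * x κ + v κ) := by
      refine Primrec.ratVecData_gridPoint ?_ (Primrec.fin_pi fun κ => ?_)
      · exact Primrec.nat_add.comp (Primrec.fst.comp (Primrec.fst.comp (Primrec.fst.comp
          (Primrec.fst.comp Primrec.fst)))) (Primrec.const n)
      · exact Primrec.int_add.comp (Primrec.int_mul.comp (Primrec.const _)
          (Primrec.fin_apply Primrec.snd κ)) (Primrec.const _)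
    have hG : Partrec fun q : (((ℕ × ℕ) × ℕ) × ℕ) × ℕ => (E q.1).map fun x =>
        ratVecData (gridPoint (q.1.1.1.1 + n) fun κ => 2 ^ n * x κ + v κ) :=
      (hE.comp Computable.fst).map hout.to_comp
    have hlen : Primrec fun h : (ℕ × ℕ) × ℕ => h.1.2 - h.2 :=
      Primrec.nat_sub.comp (Primrec.snd.comp Primrec.fst) Primrec.snd
    obtain ⟨c, hc⟩ := hU.exists_program_of_partrec hG hlen
    refine ⟨c, fun d ℓ k i z x hi hx hv => ?_⟩
    obtain ⟨π, hπ, hl⟩ := hc ∅ ((d, ℓ), k) i 0 _ hi (Part.mem_map _ hx)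
    have hgrid : (fun κ => 2 ^ n * x κ + v κ) = fun κ => ⌊(2 : ℝ) ^ (d + n) * z κ⌋ := by
      funext κ
      rw [hv]
      ring
    rw [hgrid] at hπ
    exact pointComplexity_le (gridPoint_floor_mem_ratBall d z) hπ hl
  obtain ⟨c, hc⟩ := exists_uniform_bound (intBox n K) (fun v c c' hcc' h d ℓ k i z x hi hx hv =>
    (h d ℓ k i z x hi hx hv).trans (by exact_mod_cast Nat.add_le_add_left hcc' _)) key
  exact ⟨c, fun d ℓ k i z x hi hx hv => hc _ (mem_intBox.2 hv) d ℓ k i z x hi hx rfl⟩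

end OracleCode.IsUniversalPrefixFree

/-! ### Directions orthogonal to a segment -/

section Direction

variable {n : ℕ}

/-- The segment from `z` to `w` is orthogonal to `e`, has length at least `2 ^ (-r)`, and is
transversal to `e` in the plane of the `i`-th and `j`-th coordinates. -/
structure IsTransversal (e z w : EuclideanSpace ℝ (Fin n)) (i j : Fin n) (r : ℕ) : Prop where
  ne : i ≠ j
  inner_eq : inner ℝ e z = inner ℝ e w
  one_le : 1 ≤ 2 ^ r * ‖z - w‖
  norm_le : ‖z - w‖ ≤ n * |e i * (w j - z j) - e j * (w i - z i)|

theorem IsTransversal.norm_pos {e z w : EuclideanSpace ℝ (Fin n)} {i j : Fin n} {r : ℕ}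
    (h : IsTransversal e z w i j r) : 0 < ‖z - w‖ :=
  pos_of_mul_pos_right (zero_lt_one.trans_le h.one_le) (by positivity)

theorem inner_eq_sum (x y : EuclideanSpace ℝ (Fin n)) : inner ℝ x y = ∑ k, x k * y k := by
  simp [PiLp.inner_apply, mul_comm]

theorem norm_sq_eq_sum (x : EuclideanSpace ℝ (Fin n)) : ‖x‖ ^ 2 = ∑ k, x k ^ 2 := by
  rw [EuclideanSpace.norm_sq_eq]
  simp

theorem sum_mul_sub_eq_zero {e z w : EuclideanSpace ℝ (Fin n)}
    (h : inner ℝ e z = inner ℝ e w) : ∑ k, e k * (w k - z k) = 0 := by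
  rw [inner_eq_sum, inner_eq_sum] at h
  simp only [mul_sub, Finset.sum_sub_distrib, h, sub_self]

theorem sum_sub_sq_eq (z w : EuclideanSpace ℝ (Fin n)) :
    ∑ k, (w k - z k) ^ 2 = ‖z - w‖ ^ 2 := by
  rw [norm_sub_rev, norm_sq_eq_sum]
  rfl

theorem exists_isTransversal {e z w : EuclideanSpace ℝ (Fin n)} (he : ‖e‖ = 1)
    (h : inner ℝ e z = inner ℝ e w) (hzw : z ≠ w) {r : ℕ} (hr : 1 ≤ 2 ^ r * ‖z - w‖) :
    ∃ i j, IsTransversal e z w i j r := by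
  obtain ⟨i, j, hij, hle⟩ := exists_pair_le_abs_det (e := fun k => e k)
    (u := fun k => w k - z k) (by rw [← norm_sq_eq_sum, he, one_pow])
    (norm_sub_pos_iff.2 hzw) (sum_sub_sq_eq z w) (sum_mul_sub_eq_zero h)
  exact ⟨i, j, hij, h, hr, hle⟩

theorem abs_floor_sub_floor_le (a b : ℝ) : |((⌊a⌋ - ⌊b⌋ : ℤ) : ℝ)| ≤ |a - b| + 1 := by
  have h1 := Int.floor_le a
  have h2 := Int.lt_floor_add_one a
  have h3 := Int.floor_le b
  have h4 := Int.lt_floor_add_one b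
  have h5 := le_abs_self (a - b)
  have h6 := neg_abs_le (a - b)
  push_cast
  rw [abs_le]
  constructor <;> linarith

/-- What the estimates `w'` and `q` of `w` and `z` miss in the difference of the truncations. -/
noncomputable def floorCorrection (d : ℕ) (z w : EuclideanSpace ℝ (Fin n)) (q w' : Fin n → ℚ) :
    Fin n → ℤ := fun k =>
  (⌊(2 : ℝ) ^ d * w k⌋ - ⌊(2 : ℝ) ^ d * z k⌋) -
    (⌊(2 : ℝ) ^ d * (w' k : ℝ)⌋ - ⌊(2 : ℝ) ^ d * (q k : ℝ)⌋)

/-- At scale `2 ^ (r + c)` an estimate of precision `r` is off by at most `2 ^ c`, plus `1` for the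
floors. The bound does not depend on `r` or on the points, so finitely many corrections occur. -/
theorem floorCorrection_mem_intBox {r c : ℕ} {z w : EuclideanSpace ℝ (Fin n)} {q w' : Fin n → ℚ}
    (hq : q ∈ ratBall r z) (hw' : w' ∈ ratBall r w) :
    floorCorrection (r + c) z w q w' ∈ intBox n (2 * (2 ^ c + 1)) := by
  have key : ∀ {x : EuclideanSpace ℝ (Fin n)} {p : Fin n → ℚ}, p ∈ ratBall r x → ∀ k,
      |((⌊(2 : ℝ) ^ (r + c) * x k⌋ - ⌊(2 : ℝ) ^ (r + c) * (p k : ℝ)⌋ : ℤ) : ℝ)| ≤ 2 ^ c + 1 := by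
    intro x p hp k
    refine (abs_floor_sub_floor_le _ _).trans (add_le_add_left ?_ 1)
    rw [← mul_sub, abs_mul, abs_sub_comm, abs_of_pos (by positivity)]
    have h1 := (abs_sub_lt_of_mem_ratBall hp k).le
    rw [zpow_neg, zpow_natCast] at h1
    refine (mul_le_mul_of_nonneg_left h1 (by positivity)).trans_eq ?_
    rw [pow_add]
    field_simp
  refine mem_intBox.2 fun k => ?_
  have h1 := key hq k
  have h2 := key hw' k
  have h1' : |⌊(2 : ℝ) ^ (r + c) * z k⌋ - ⌊(2 : ℝ) ^ (r + c) * (q k : ℝ)⌋| ≤ 2 ^ c + 1 := by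
    exact_mod_cast h1
  have h2' : |⌊(2 : ℝ) ^ (r + c) * w k⌋ - ⌊(2 : ℝ) ^ (r + c) * (w' k : ℝ)⌋| ≤ 2 ^ c + 1 := by
    exact_mod_cast h2
  rw [abs_le] at h1' h2' ⊢
  simp only [floorCorrection]
  constructor <;> linarith [h1'.1, h1'.2, h2'.1, h2'.2]

/-- The correction `v` turns the difference of the truncated estimates into the difference of the
floors of the true points at the finer scale `N`. The search then works with `N * (w - z)` up to an
error of `1` per coordinate. -/
theorem exists_direction_machine {e : EuclideanSpace ℝ (Fin n)} (he : ‖e‖ = 1) (i j : Fin n)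
    (v : Fin n → ℤ) :
    ∃ B : OracleCode, ∀ (r : ℕ) (z w : EuclideanSpace ℝ (Fin n)) (q w' : Fin n → ℚ),
      IsTransversal e z w i j r → floorCorrection (r + (2 * n + 7)) z w q w' = v →
      ∃ p : Fin n → ℚ, ∑ k, |(p k : ℝ) - e k| < 1 / (2 * (2 ^ r * ‖z - w‖)) ∧
        encode (ratVecData p) ∈ B.eval (realOracle (removeTwo e i j))
          (encode ((r, encode (ratVecData w')), encode (ratVecData q))) := by
  have he1 : ∑ k, e k ^ 2 = 1 := by rw [← norm_sq_eq_sum, he, one_pow]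
  have hek : ∀ k, -2 ≤ e k := fun k => by
    have := (abs_le.1 (abs_le_one_of_sum_sq he1 k)).1
    linarith
  obtain ⟨B, hB⟩ := exists_search_code hek i j (fun k => ⌊(2 : ℝ) ^ (n + 3) * e k⌋)
    (2 * n + 7) v (A := realOracle (removeTwo e i j)) rfl
  refine ⟨B, fun r z w q w' ht hv => ?_⟩
  set N : ℝ := 2 ^ (r + (2 * n + 7)) with hN
  set D := ‖z - w‖ with hD
  have hDpos : 0 < D := ht.norm_pos
  have hrD : 1 ≤ 2 ^ r * D := ht.one_le
  -- The `2 * n + 7` extra bits provide the factor `128 * 4 ^ n`, which exceeds twice the stability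
  -- constant `60 * n ^ 2`.
  have hNeq : N * D = 2 ^ r * D * (128 * (2 ^ n * 2 ^ n)) := by
    rw [hN, pow_add, pow_add, two_mul, pow_add]
    norm_num
    ring
  have hn : (n : ℝ) ≤ 2 ^ n := by exact_mod_cast Nat.lt_two_pow_self.le
  have hn1 : (1 : ℝ) ≤ 2 ^ n := one_le_pow₀ (by norm_num)
  have hn0 : (0 : ℝ) ≤ n := by positivity
  have hnn : (n : ℝ) ^ 2 ≤ 2 ^ n * 2 ^ n := by nlinarith
  set u : Fin n → ℤ := fun k => ⌊N * w k⌋ - ⌊N * z k⌋ with hu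
  have hu1 : ∀ k, |(u k : ℝ) - N * (w k - z k)| ≤ 1 := by
    intro k
    have h1 := Int.floor_le (N * w k)
    have h2 := Int.lt_floor_add_one (N * w k)
    have h3 := Int.floor_le (N * z k)
    have h4 := Int.lt_floor_add_one (N * z k)
    simp only [hu]
    push_cast
    rw [abs_le]
    constructor <;> linarith
  have hdir : directionCode (2 * n + 7) v
      ((r, encode (ratVecData w')), encode (ratVecData q)) = u := by
    rw [directionCode, truncCode_encode, truncCode_encode, ← hv]
    funext k
    simp only [Pi.add_apply, Pi.sub_apply, floorCorrection, hu, hN]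
    ring
  obtain ⟨g, b, hg, hb, hmem⟩ := hB ((r, encode (ratVecData w')), encode (ratVecData q)) u _ hdir
    rfl fun g hg => ⟨_, isCandidate_floor (v := fun k => w k - z k) i j he1
      (sum_mul_sub_eq_zero ht.inner_eq) hu1 (fun _ => rfl) hg rfl⟩
  refine ⟨_, ?_, hmem⟩
  refine (hb.sum_abs_sub_le (v := fun k => w k - z k) ht.ne he1
    (sum_mul_sub_eq_zero ht.inner_eq) hDpos (sum_sub_sq_eq z w) (by positivity) ?_ ht.norm_le hu1
    (fun _ => rfl) hg rfl).trans_lt ?_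
  · rw [hNeq]
    nlinarith
  · rw [div_lt_div_iff₀ (by positivity) (by positivity), hNeq]
    have h1 : (0 : ℝ) < 2 ^ r * D := by positivity
    have h2 : (0 : ℝ) < 2 ^ n * 2 ^ n := by positivity
    nlinarith

end Direction

/-! ### Upper bounds on the conditional complexity of the direction -/

theorem pointCondComplexity_le {m n : ℕ} {U : OracleCode} {A : Set ℕ} {r s : ℤ}
    {x : EuclideanSpace ℝ (Fin m)} {y : EuclideanSpace ℝ (Fin n)} {c : ℕ}
    (h : ∀ q ∈ ratBall s y, ∃ p ∈ ratBall r x, ∃ π : List Bool,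
      encode (ratVecData p) ∈ U.run A π (encode (ratVecData q)) ∧ π.length ≤ c) :
    pointCondComplexity U A r s x y ≤ c := by
  refine iSup₂_le fun q hq => ?_
  obtain ⟨p, hp, π, hπ, hc⟩ := h q hq
  exact (iInf₂_le p hp).trans (condComplexity_le_of_mem_run hπ hc)

/-- Rounding `r - t` up raises it by less than `1`; the factor `2` on the left pays for this. -/
theorem zpow_neg_ceil_gt {D : ℝ} (hD : 0 < D) {t : ℝ} (ht : t = -Real.logb 2 D) (r : ℕ) :
    1 / (2 * (2 ^ r * D)) < (2 : ℝ) ^ (-⌈(r : ℝ) - t⌉) := by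
  have h1 : (2 : ℝ) ^ (Real.logb 2 D) = D := Real.rpow_logb (by norm_num) (by norm_num) hD
  have h2 : 1 / (2 * (2 ^ r * D)) = (2 : ℝ) ^ (-((r : ℝ) - t + 1)) := by
    have h3 : (r : ℝ) - t + 1 = r + Real.logb 2 D + 1 := by rw [ht]; ring
    rw [h3, Real.rpow_neg (by norm_num), Real.rpow_add (by norm_num),
      Real.rpow_add (by norm_num), h1, Real.rpow_natCast, Real.rpow_one, one_div]
    ring
  rw [h2, ← Real.rpow_intCast]
  refine Real.rpow_lt_rpow_of_exponent_lt (by norm_num) ?_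
  push_cast
  have := Int.ceil_lt_add_one ((r : ℝ) - t)
  linarith

namespace OracleCode.IsUniversalPrefixFree

variable {U : OracleCode} {n : ℕ} {e : EuclideanSpace ℝ (Fin n)}

/-- The program of `w'` is reused as it stands, and is self-delimiting because `U` is prefix-free.
Only `r` is added as a hint. -/
theorem exists_pointCondComplexity_le_length (hU : U.IsUniversalPrefixFree) (he : ‖e‖ = 1)
    (i j : Fin n) :
    ∃ c : ℕ, ∀ (r : ℕ) (z w : EuclideanSpace ℝ (Fin n)) (t : ℝ) (w' : Fin n → ℚ) (π : List Bool),
      IsTransversal e z w i j r → t = -Real.logb 2 ‖z - w‖ → w' ∈ ratBall r w →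
      encode (ratVecData w') ∈ U.run ∅ π 0 →
      pointCondComplexity U (realOracle (removeTwo e i j)) ⌈(r : ℝ) - t⌉ r e z ≤
        (2 * Nat.size r + π.length + c : ℕ) := by
  have hrun : Partrec fun q : (ℕ × List Bool) × ℕ =>
      (U.eval ∅ (encode (q.1.2, 0))).map fun w => ((q.1.1, w), q.2) := by
    have hfst : Computable fun q : (ℕ × List Bool) × ℕ => encode (q.1.2, 0) :=
      (Primrec.encode.comp (Primrec.pair (Primrec.snd.comp Primrec.fst)
        (Primrec.const 0))).to_comp
    refine Partrec.map ((Partrec.nat_iff.2 U.partrec_eval_empty).comp hfst) ?_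
    exact (Primrec.pair (Primrec.pair (Primrec.fst.comp (Primrec.fst.comp Primrec.fst))
      Primrec.snd) (Primrec.snd.comp Primrec.fst)).to_comp
  have key : ∀ v : Fin n → ℤ, ∃ c : ℕ, ∀ (r : ℕ) (z w : EuclideanSpace ℝ (Fin n)) (t : ℝ)
      (q w' : Fin n → ℚ) (π : List Bool), floorCorrection (r + (2 * n + 7)) z w q w' = v →
      IsTransversal e z w i j r → t = -Real.logb 2 ‖z - w‖ → 0 < ‖z - w‖ →
      encode (ratVecData w') ∈ U.run ∅ π 0 →
      ∃ p ∈ ratBall ⌈(r : ℝ) - t⌉ e, ∃ ρ : List Bool, encode (ratVecData p) ∈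
        U.run (realOracle (removeTwo e i j)) ρ (encode (ratVecData q)) ∧
        ρ.length ≤ 2 * Nat.size r + π.length + c := by
    intro v
    obtain ⟨B, hB⟩ := exists_direction_machine he i j v
    obtain ⟨c, hc⟩ := hU.exists_condComplexity_le hrun
      (fun h y ρ ρ' hd hd' hp => hU.1 ∅ 0 ρ ρ' hd hd' hp) B
    refine ⟨c, fun r z w t q w' π hv htr ht hD hπ => ?_⟩
    obtain ⟨p, hp, hmem⟩ := hB r z w q w' htr hv
    refine ⟨p, mem_ratBall_of_sum_lt (hp.trans (zpow_neg_ceil_gt hD ht r)), ?_⟩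
    exact hc _ r π _ _ _ (Part.mem_map _ hπ) hmem
  obtain ⟨c, hc⟩ := exists_uniform_bound (intBox n (2 * (2 ^ (2 * n + 7) + 1)))
    (fun v c c' hcc' h r z w t q w' π hv htr ht hD hπ => by
      obtain ⟨p, hp, ρ, hρ, hl⟩ := h r z w t q w' π hv htr ht hD hπ
      exact ⟨p, hp, ρ, hρ, hl.trans (Nat.add_le_add_left hcc' _)⟩) key
  refine ⟨c, fun r z w t w' π htr ht hw' hπ => pointCondComplexity_le fun q hq => ?_⟩
  exact hc _ (floorCorrection_mem_intBox hq hw') r z w t q w' π rfl htr ht htr.norm_pos hπ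

/-- The feature of `w'` is free: it is the truncation of `q` plus a bounded correction built into
the machine. Apart from the hint, only the index of `w'` in its fibre is paid for. -/
theorem exists_pointCondComplexity_le_index (hU : U.IsUniversalPrefixFree) (he : ‖e‖ = 1)
    {E : ((ℕ × ℕ) × (Fin n → ℤ)) × ℕ →. ℕ} (hE : Partrec E) (K : ℤ) (i j : Fin n) :
    ∃ c : ℕ, ∀ (r d ℓ k ι : ℕ) (z w : EuclideanSpace ℝ (Fin n)) (t : ℝ) (w' : Fin n → ℚ),
      IsTransversal e z w i j r → t = -Real.logb 2 ‖z - w‖ → w' ∈ ratBall r w → ι < 2 ^ (k + 1) →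
      encode (ratVecData w') ∈ E (((d, ℓ), truncCode n d (encode (ratVecData w'))), ι) →
      (∀ q ∈ ratBall r z, truncCode n d (encode (ratVecData w')) -
        truncCode n d (encode (ratVecData q)) ∈ intBox n K) →
      pointCondComplexity U (realOracle (removeTwo e i j)) ⌈(r : ℝ) - t⌉ r e z ≤
        (2 * Nat.size (encode (r, ((d, ℓ), k))) + (k + 1) + c : ℕ) := by
  have key : ∀ v : (Fin n → ℤ) × (Fin n → ℤ), ∃ c : ℕ, ∀ (r d ℓ k ι : ℕ)
      (z w : EuclideanSpace ℝ (Fin n)) (t : ℝ) (q w' : Fin n → ℚ),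
      floorCorrection (r + (2 * n + 7)) z w q w' = v.1 →
      truncCode n d (encode (ratVecData w')) - truncCode n d (encode (ratVecData q)) = v.2 →
      IsTransversal e z w i j r → t = -Real.logb 2 ‖z - w‖ → 0 < ‖z - w‖ → ι < 2 ^ (k + 1) →
      encode (ratVecData w') ∈ E (((d, ℓ), truncCode n d (encode (ratVecData w'))), ι) →
      ∃ p ∈ ratBall ⌈(r : ℝ) - t⌉ e, ∃ ρ : List Bool, encode (ratVecData p) ∈
        U.run (realOracle (removeTwo e i j)) ρ (encode (ratVecData q)) ∧
        ρ.length ≤ 2 * Nat.size (encode (r, ((d, ℓ), k))) + (k + 1) + c := by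
    rintro ⟨v, v'⟩
    obtain ⟨B, hB⟩ := exists_direction_machine he i j v
    have hG : Partrec fun x : ((ℕ × ((ℕ × ℕ) × ℕ)) × ℕ) × ℕ =>
        (E ((x.1.1.2.1, truncCode n x.1.1.2.1.1 x.2 + v'), x.1.2)).map
          fun w => ((x.1.1.1, w), x.2) := by
      have hdl : Primrec fun x : ((ℕ × ((ℕ × ℕ) × ℕ)) × ℕ) × ℕ => x.1.1.2.1 :=
        Primrec.fst.comp (Primrec.snd.comp (Primrec.fst.comp Primrec.fst))
      have harg : Primrec fun x : ((ℕ × ((ℕ × ℕ) × ℕ)) × ℕ) × ℕ =>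
          ((x.1.1.2.1, truncCode n x.1.1.2.1.1 x.2 + v'), x.1.2) :=
        Primrec.pair (Primrec.pair hdl (primrec_int_vec_add.comp
          (primrec_truncCode.comp (Primrec.fst.comp hdl) Primrec.snd) (Primrec.const v')))
          (Primrec.snd.comp Primrec.fst)
      refine Partrec.map (hE.comp harg.to_comp) ?_
      exact (Primrec.pair (Primrec.pair (Primrec.fst.comp (Primrec.fst.comp
        (Primrec.fst.comp Primrec.fst))) Primrec.snd) (Primrec.snd.comp Primrec.fst)).to_comp
    have hlen : Primrec fun h : ℕ × ((ℕ × ℕ) × ℕ) => h.2.2 + 1 :=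
      Primrec.succ.comp (Primrec.snd.comp Primrec.snd)
    obtain ⟨c, hc⟩ := hU.exists_program_of_index hG hlen B
    refine ⟨c, fun r d ℓ k ι z w t q w' hv hv' htr ht hD hι hw' => ?_⟩
    obtain ⟨p, hp, hmem⟩ := hB r z w q w' htr hv
    refine ⟨p, mem_ratBall_of_sum_lt (hp.trans (zpow_neg_ceil_gt hD ht r)), ?_⟩
    refine hc _ (r, ((d, ℓ), k)) ι _ _ _ hι (Part.mem_map _ ?_) hmem
    have h1 : truncCode n d (encode (ratVecData q)) + v' =
        truncCode n d (encode (ratVecData w')) := by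
      rw [← show _ = v' from hv']
      abel
    simp only [h1]
    exact hw'
  obtain ⟨c, hc⟩ := exists_uniform_bound
    ((intBox n (2 * (2 ^ (2 * n + 7) + 1))) ×ˢ (intBox n K))
    (fun v c c' hcc' h r d ℓ k ι z w t q w' hv hv' htr ht hD hι hw' => by
      obtain ⟨p, hp, ρ, hρ, hl⟩ := h r d ℓ k ι z w t q w' hv hv' htr ht hD hι hw'
      exact ⟨p, hp, ρ, hρ, hl.trans (Nat.add_le_add_left hcc' _)⟩) key
  refine ⟨c, fun r d ℓ k ι z w t w' htr ht hw' hι hmem hK =>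
    pointCondComplexity_le fun q hq => ?_⟩
  exact hc (_, _) (Finset.mem_product.2 ⟨floorCorrection_mem_intBox hq hw', hK q hq⟩)
    r d ℓ k ι z w t q w' rfl rfl htr ht htr.norm_pos hι hmem

end OracleCode.IsUniversalPrefixFree

/-! ### The lower bound for the complexity of a point -/

section LowerBound

variable {U : OracleCode} {n : ℕ}

theorem logb_le_of_le {D : ℝ} (hD : 0 < D) {r : ℕ} (h : -Real.logb 2 D ≤ r) : 1 ≤ 2 ^ r * D := by
  have h1 : (2 : ℝ) ^ (Real.logb 2 D) = D := Real.rpow_logb (by norm_num) (by norm_num) hD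
  have h2 : (1 : ℝ) ≤ (2 : ℝ) ^ ((r : ℝ) + Real.logb 2 D) :=
    Real.one_le_rpow (by norm_num) (by linarith)
  rwa [Real.rpow_add (by norm_num), h1, Real.rpow_natCast] at h2

theorem two_pow_ceil_mul_le {D : ℝ} (hD : 0 < D) {d : ℕ} (h : (d : ℤ) = ⌈-Real.logb 2 D⌉) :
    2 ^ d * D ≤ 2 := by
  have h1 : (2 : ℝ) ^ (Real.logb 2 D) = D := Real.rpow_logb (by norm_num) (by norm_num) hD
  have h2 : (d : ℝ) < -Real.logb 2 D + 1 := by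
    have h3 : ((d : ℤ) : ℝ) = (⌈-Real.logb 2 D⌉ : ℤ) := by rw [h]
    rw [Int.cast_natCast] at h3
    rw [h3]
    exact Int.ceil_lt_add_one _
  have h4 : (2 : ℝ) ^ ((d : ℝ) + Real.logb 2 D) ≤ 2 ^ (1 : ℝ) :=
    Real.rpow_le_rpow_of_exponent_le (by norm_num) (by linarith)
  rwa [Real.rpow_add (by norm_num), h1, Real.rpow_natCast, Real.rpow_one] at h4

/-- The pair `(i, j)` depends on `w`, so the constants have to be made uniform over all pairs. -/
theorem exists_uniform_bound_pairs {P : Fin n → Fin n → ℕ → Prop}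
    (hmono : ∀ i j c c', c ≤ c' → P i j c → P i j c') (h : ∀ i j, ∃ c, P i j c) :
    ∃ c, ∀ i j, P i j c := by
  obtain ⟨c, hc⟩ := exists_uniform_bound (Finset.univ : Finset (Fin n × Fin n))
    (P := fun v => P v.1 v.2) (fun v c c' hcc' => hmono v.1 v.2 c c' hcc') fun v => h v.1 v.2
  exact ⟨c, fun i j => hc (i, j) (Finset.mem_univ _)⟩

theorem pow_mul_abs_sub_le_one {r d : ℕ} (hdr : d ≤ r) {x : EuclideanSpace ℝ (Fin n)}
    {p : Fin n → ℚ} (hp : p ∈ ratBall r x) (k : Fin n) :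
    2 ^ d * |(p k : ℝ) - x k| ≤ 1 := by
  have h1 := (abs_sub_lt_of_mem_ratBall hp k).le
  rw [zpow_neg, zpow_natCast] at h1
  refine (mul_le_mul_of_nonneg_left h1 (by positivity)).trans ?_
  rw [← div_eq_mul_inv, div_le_one (by positivity)]
  exact pow_le_pow_right₀ (by norm_num) hdr

/-- In units of `2 ^ (-d)` the distance of `z` and `w` contributes `2`, the estimate `1` and its
floor `1`. So the truncation of `w'` also describes `z` at precision `d`. -/
theorem abs_floor_sub_truncation_le {r d : ℕ} (hdr : d ≤ r) {z w : EuclideanSpace ℝ (Fin n)}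
    (hzw : 2 ^ d * ‖z - w‖ ≤ 2) {w' : Fin n → ℚ} (hw' : w' ∈ ratBall r w) (k : Fin n) :
    |⌊(2 : ℝ) ^ (d + n) * z k⌋ - 2 ^ n * ⌊(2 : ℝ) ^ d * (w' k : ℝ)⌋| ≤ 2 ^ n * 5 := by
  have h1 := abs_floor_sub_le ((2 : ℝ) ^ (d + n) * z k)
  have h2 := abs_floor_sub_le ((2 : ℝ) ^ d * (w' k : ℝ))
  have h3 := pow_mul_abs_sub_le_one hdr hw' k
  have h4 : 2 ^ d * |z k - w k| ≤ 2 :=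
    (mul_le_mul_of_nonneg_left (abs_apply_le_norm (z - w) k) (by positivity)).trans hzw
  rw [← abs_of_pos (by positivity : (0 : ℝ) < 2 ^ d), ← abs_mul] at h3 h4
  have h5 : (1 : ℝ) ≤ 2 ^ n := one_le_pow₀ (by norm_num)
  have h6 : (⌊(2 : ℝ) ^ (d + n) * z k⌋ : ℝ) - 2 ^ n * ⌊(2 : ℝ) ^ d * (w' k : ℝ)⌋ =
      (⌊(2 : ℝ) ^ (d + n) * z k⌋ - (2 : ℝ) ^ (d + n) * z k) +
      2 ^ n * (2 ^ d * (z k - w k) - 2 ^ d * (w' k - w k) -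
        (⌊(2 : ℝ) ^ d * (w' k : ℝ)⌋ - 2 ^ d * w' k)) := by
    rw [pow_add]
    ring
  have h7 : |2 ^ d * (z k - w k) - 2 ^ d * (w' k - w k) -
        (⌊(2 : ℝ) ^ d * (w' k : ℝ)⌋ - 2 ^ d * w' k)| ≤ 4 := by
    rw [abs_le] at h2 h3 h4 ⊢
    constructor <;> linarith [h2.1, h2.2, h3.1, h3.2, h4.1, h4.2]
  have h8 : |(⌊(2 : ℝ) ^ (d + n) * z k⌋ : ℝ) - 2 ^ n * ⌊(2 : ℝ) ^ d * (w' k : ℝ)⌋| ≤ 2 ^ n * 5 := by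
    rw [h6]
    refine (abs_add_le _ _).trans ?_
    rw [abs_mul, abs_of_pos (by positivity : (0 : ℝ) < 2 ^ n)]
    have := mul_le_mul_of_nonneg_left h7 (by positivity : (0 : ℝ) ≤ 2 ^ n)
    linarith
  exact_mod_cast h8

theorem truncCode_sub_mem_intBox {r d : ℕ} (hdr : d ≤ r) {z w : EuclideanSpace ℝ (Fin n)}
    (hzw : 2 ^ d * ‖z - w‖ ≤ 2) {q w' : Fin n → ℚ} (hq : q ∈ ratBall r z)
    (hw' : w' ∈ ratBall r w) :
    truncCode n d (encode (ratVecData w')) - truncCode n d (encode (ratVecData q)) ∈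
      intBox n 5 := by
  rw [truncCode_encode, truncCode_encode, mem_intBox]
  intro k
  have h1 := pow_mul_abs_sub_le_one hdr hq k
  have h3 := pow_mul_abs_sub_le_one hdr hw' k
  have h4 : 2 ^ d * |z k - w k| ≤ 2 :=
    (mul_le_mul_of_nonneg_left (abs_apply_le_norm (z - w) k) (by positivity)).trans hzw
  have h5 : |(w' k : ℝ) - q k| ≤ |(w' k : ℝ) - w k| + |z k - w k| + |(q k : ℝ) - z k| := by
    have h6 := abs_sub_le (w' k : ℝ) (w k) (q k)
    have h7 := abs_sub_le (w k) (z k) (q k : ℝ)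
    have h8 := abs_sub_comm (w k) (z k)
    have h9 := abs_sub_comm (z k) (q k : ℝ)
    linarith
  have h6 := abs_floor_sub_floor_le ((2 : ℝ) ^ d * (w' k : ℝ)) ((2 : ℝ) ^ d * (q k : ℝ))
  rw [← mul_sub, abs_mul, abs_of_pos (by positivity : (0 : ℝ) < 2 ^ d)] at h6
  have h7 := mul_le_mul_of_nonneg_left h5 (by positivity : (0 : ℝ) ≤ 2 ^ d)
  rw [mul_add, mul_add] at h7
  have h8 : |((⌊(2 : ℝ) ^ d * (w' k : ℝ)⌋ - ⌊(2 : ℝ) ^ d * (q k : ℝ)⌋ : ℤ) : ℝ)| ≤ 5 := by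
    linarith
  exact_mod_cast h8

/-- The case of a distance of at least `1`. -/
theorem exists_lower_bound_of_nonpos (hU : U.IsUniversalPrefixFree)
    (z : EuclideanSpace ℝ (Fin n)) {e : EuclideanSpace ℝ (Fin n)} (he : ‖e‖ = 1) :
    ∃ C : ℕ, ∀ r : ℕ, 2 ≤ r → ∀ (w : EuclideanSpace ℝ (Fin n)) (t : ℝ) (i j : Fin n)
      (w' : Fin n → ℚ) (π : List Bool), IsTransversal e z w i j r → t = -Real.logb 2 ‖z - w‖ →
      t ≤ 0 → w' ∈ ratBall r w → encode (ratVecData w') ∈ U.run ∅ π 0 →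
        pointComplexity U ∅ ⌈t⌉ z +
          pointCondComplexity U (realOracle (removeTwo e i j)) ⌈(r : ℝ) - t⌉ r e z ≤
        (π.length + C * Nat.log 2 r : ℕ) := by
  obtain ⟨s, hs⟩ := pow_unbounded_of_one_lt ‖z‖ (one_lt_two (α := ℝ))
  obtain ⟨C₁, hC₁⟩ := hU.exists_pointComplexity_le_mul n s
  obtain ⟨C₂, hC₂⟩ := exists_uniform_bound_pairs (fun i j c c' hcc' h r z w t w' π h1 h2 h3 h4 =>
    (h r z w t w' π h1 h2 h3 h4).trans (by exact_mod_cast Nat.add_le_add_left hcc' _))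
    fun i j => hU.exists_pointCondComplexity_le_length he i j
  refine ⟨C₁ + C₂ + 4, fun r hr w t i j w' π htr ht ht0 hw' hπ => ?_⟩
  -- A nonpositive precision demands no more than precision `1`, at which the complexity of the
  -- fixed point `z` is a constant.
  have h1 : pointComplexity U ∅ ⌈t⌉ z ≤ (C₁ * 1 : ℕ) := by
    refine (pointComplexity_mono U ∅ ?_ z).trans
      (hC₁ 1 le_rfl z fun k => (abs_apply_le_norm z k).trans hs.le)
    exact Int.ceil_le.2 (by push_cast; linarith)
  have h2 := hC₂ i j r z w t w' π htr ht hw' hπ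
  refine (add_le_add h1 h2).trans ?_
  have hlog : 1 ≤ Nat.log 2 r := Nat.log_pos (by norm_num) hr
  have hsz := size_le_two_mul_log hr
  have h3 : C₁ ≤ C₁ * Nat.log 2 r := Nat.le_mul_of_pos_right _ hlog
  have h4 : C₂ ≤ C₂ * Nat.log 2 r := Nat.le_mul_of_pos_right _ hlog
  rw [← Nat.cast_add, Nat.cast_le]
  have h5 : (C₁ + C₂ + 4) * Nat.log 2 r =
    C₁ * Nat.log 2 r + C₂ * Nat.log 2 r + 4 * Nat.log 2 r := by ring
  omega

/-- The case of a distance of less than `1`. -/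
theorem exists_lower_bound_of_pos (hU : U.IsUniversalPrefixFree)
    (z : EuclideanSpace ℝ (Fin n)) {e : EuclideanSpace ℝ (Fin n)} (he : ‖e‖ = 1) :
    ∃ C : ℕ, ∀ r : ℕ, 2 ≤ r → ∀ (w : EuclideanSpace ℝ (Fin n)) (t : ℝ) (i j : Fin n)
      (w' : Fin n → ℚ) (π : List Bool), IsTransversal e z w i j r → t = -Real.logb 2 ‖z - w‖ →
      0 < t → t ≤ r → w' ∈ ratBall r w → encode (ratVecData w') ∈ U.run ∅ π 0 →
      (π.length : ℕ∞) ≤ pointComplexity U ∅ r w →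
        pointComplexity U ∅ ⌈t⌉ z +
          pointCondComplexity U (realOracle (removeTwo e i j)) ⌈(r : ℝ) - t⌉ r e z ≤
        (π.length + C * Nat.log 2 r : ℕ) := by
  -- For `t > 0` the point `w` lies within distance `1` of `z`, so one box contains all such `w` and
  -- `C₀` depends on `z` and `n` only.
  obtain ⟨s, hs⟩ := pow_unbounded_of_one_lt (‖z‖ + 1) (one_lt_two (α := ℝ))
  obtain ⟨C₀, hC₀⟩ := hU.exists_pointComplexity_le_mul n s
  obtain ⟨E, E', hE, hE', hsplit⟩ :=
    exists_two_part_description U (primrec_truncCode (n := n))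
  obtain ⟨C₁, hC₁⟩ := hU.exists_pointComplexity_le_of_feature n hE' (2 ^ n * 5)
  obtain ⟨C₂, hC₂⟩ := exists_uniform_bound_pairs
    (fun i j c c' hcc' h r d ℓ k ι z w t w' h1 h2 h3 h4 h5 h6 =>
      (h r d ℓ k ι z w t w' h1 h2 h3 h4 h5 h6).trans
        (by exact_mod_cast Nat.add_le_add_left hcc' _))
    fun i j => hU.exists_pointCondComplexity_le_index he hE 5 i j
  -- The index lengths `ℓ - k` and `k + 1` add up to `ℓ + 1`. The hints have sizes at most `4 * M`
  -- and `8 * M`, and doubling both gives `24 * M`.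
  refine ⟨C₁ + C₂ + 1 + 24 * (Nat.size (C₀ + 1) + 2),
    fun r hr w t i j w' π htr ht ht0 htr' hw' hπ hle => ?_⟩
  have hD := htr.norm_pos
  obtain ⟨d, hd⟩ : ∃ d : ℕ, (d : ℤ) = ⌈t⌉ :=
    ⟨⌈t⌉.toNat, Int.toNat_of_nonneg (Int.ceil_nonneg ht0.le)⟩
  have hdr : d ≤ r := by
    have : ⌈t⌉ ≤ (r : ℤ) := Int.ceil_le.2 (by exact_mod_cast htr')
    omega
  have hdD : 2 ^ d * ‖z - w‖ ≤ 2 := two_pow_ceil_mul_le hD (by rw [hd, ht])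
  have hzw1 : ‖z - w‖ ≤ 1 := by
    by_contra hcon
    have := Real.logb_pos (one_lt_two) (not_le.1 hcon)
    linarith
  have hℓ : π.length ≤ C₀ * r := by
    have h1 := hC₀ r (by omega) w fun k => by
      refine (abs_apply_le_norm w k).trans (le_trans ?_ hs.le)
      have h2 := norm_sub_norm_le w z
      rw [norm_sub_rev] at h2
      linarith
    exact_mod_cast hle.trans h1
  obtain ⟨k, hk, ⟨ι, hι, hwE⟩, ι', hι', hxE⟩ :=
    hsplit d π.length (encode (ratVecData w')) ⟨π, rfl, hπ⟩
  have h1 := hC₁ d π.length k ι' z _ hι' hxE fun κ => by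
    rw [truncCode_encode]
    exact abs_floor_sub_truncation_le hdr hdD hw' κ
  have h2 := hC₂ i j r d π.length k ι z w t w' htr ht hw' hι hwE
    fun q hq => truncCode_sub_mem_intBox hdr hdD hq hw'
  rw [hd] at h1
  refine (add_le_add h1 h2).trans ?_
  have hlog : 1 ≤ Nat.log 2 r := Nat.log_pos (by norm_num) hr
  set M := Nat.size (C₀ + 1) + 2 * Nat.log 2 r with hM
  have hsize : ∀ a : ℕ, a ≤ (C₀ + 1) * r → Nat.size a ≤ M := fun a ha =>
    (Nat.size_le_size ha).trans ((size_mul_le _ _).trans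
      (Nat.add_le_add_left (size_le_two_mul_log hr) _))
  have hr1 : r ≤ (C₀ + 1) * r := Nat.le_mul_of_pos_left _ (Nat.succ_pos _)
  have hC₀r : C₀ * r ≤ (C₀ + 1) * r := Nat.mul_le_mul_right _ (Nat.le_succ _)
  have hs1 : Nat.size (encode ((d, π.length), k)) ≤ 4 * M := by
    have h3 := size_pair_le (hsize d (hdr.trans hr1)) (hsize π.length (hℓ.trans hC₀r))
    have h4 := size_pair_le h3 ((hsize k ((hk.trans hℓ).trans hC₀r)).trans
      (Nat.le_mul_of_pos_left M two_pos))
    refine (show Nat.size (encode ((d, π.length), k)) ≤ _ from h4).trans (by omega)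
  have hs2 : Nat.size (encode (r, ((d, π.length), k))) ≤ 8 * M := by
    have h4 := size_pair_le ((hsize r hr1).trans (by omega : M ≤ 4 * M)) hs1
    refine (show Nat.size (encode (r, ((d, π.length), k))) ≤ _ from h4).trans (by omega)
  have hMlog : M ≤ (Nat.size (C₀ + 1) + 2) * Nat.log 2 r := by
    rw [add_mul]
    exact Nat.add_le_add_right (Nat.le_mul_of_pos_right _ hlog) _
  have h3 : C₁ + C₂ + 1 ≤ (C₁ + C₂ + 1) * Nat.log 2 r := Nat.le_mul_of_pos_right _ hlog
  rw [← Nat.cast_add, Nat.cast_le, add_mul, mul_assoc 24]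
  omega

end LowerBound

/-! ### Assembling the two cases -/

theorem lemma6 (U : OracleCode) (hU : U.IsUniversalPrefixFree)
    (n : ℕ) (z e : EuclideanSpace ℝ (Fin n)) (he : e ∈ Metric.sphere 0 1) :
    ∃ C : ℕ, ∀ r : ℕ, 2 ≤ r → ∀ w : EuclideanSpace ℝ (Fin n),
      inner ℝ e z = inner ℝ e w → z ≠ w →
      ∀ t : ℝ, t = -Real.logb 2 ‖z - w‖ → t ≤ r →
        ∃ i j : Fin n, i ≠ j ∧
          pointComplexity U ∅ ⌈t⌉ z
              + pointCondComplexity U (realOracle (removeTwo e i j)) ⌈(r : ℝ) - t⌉ r e z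
            ≤ pointComplexity U ∅ r w + (C * Nat.log 2 r : ℕ) := by
  have he1 : ‖e‖ = 1 := mem_sphere_zero_iff_norm.1 he
  obtain ⟨C₁, hC₁⟩ := exists_lower_bound_of_nonpos hU z he1
  obtain ⟨C₂, hC₂⟩ := exists_lower_bound_of_pos hU z he1
  refine ⟨C₁ + C₂, fun r hr w hinner hzw t ht htr => ?_⟩
  have hD : 0 < ‖z - w‖ := norm_sub_pos_iff.2 hzw
  obtain ⟨i, j, h⟩ := exists_isTransversal he1 hinner hzw (logb_le_of_le hD (ht ▸ htr))
  refine ⟨i, j, h.ne, ?_⟩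
  -- In `ℕ∞` the inequality is trivial when the right-hand side is infinite; otherwise the infimum
  -- is attained by a program.
  by_cases htop : pointComplexity U ∅ r w = ⊤
  · rw [htop, top_add]
    exact le_top
  obtain ⟨w', hw', π, hπ, hle⟩ := exists_program_of_pointComplexity_ne_top htop
  refine le_trans ?_ (add_le_add_left hle _)
  rcases le_or_gt t 0 with ht0 | ht0
  · refine (hC₁ r hr w t i j w' π h ht ht0 hw' hπ).trans ?_
    rw [← Nat.cast_add, Nat.cast_le, add_mul]
    omega
  · refine (hC₂ r hr w t i j w' π h ht ht0 htr hw' hπ hle).trans ?_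
    rw [← Nat.cast_add, Nat.cast_le, add_mul]
    omega
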